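/- Let $\Gamma$ be a finite simple graph with at least one edge and let $p\in(0,1)$ be fixed. For $n\in\mathbb N$ let $G(n,p)$ be the Erdős–Rényi random graph on the vertex set $\{1,\dots,n\}$, in which each of the $\binom n2$ possible edges is present with probability $p$, independently of the others. Let $S=S(n,p)$ be the number of copies of $\Gamma$ in $G(n,p)$, i.e. the number of (not necessarily induced) subgraphs of $G(n,p)$ that are isomorphic to $\Gamma$, and let $$F=F_n:=\frac{S-\mathbb E[S]}{\sqrt{\operatorname{Var}[S]}}$$ (this is well defined for all sufficiently large $n$). Let $N\sim\mathcal N(0,1)$ be a standard Gaussian random variable, and let $d_K(X,Y):=\sup_{x\in\mathbb R}|P(X\le x)-P(Y\le x)|$ denote the Kolmogorov distance. Then $$d_K(F_n,N)=\mathcal O(n^{-1})\qquad\text{as } n\to\infty,$$ i.e. there are a constant $c\in(0,\infty)$ and an $n_0\in\mathbb N$, depending only on $p$ and $\Gamma$, such that $d_K(F_n,N)\le c\,n^{-1}$ for all $n\ge n_0$. -/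

import Mathlib

open MeasureTheory ProbabilityTheory Filter Asymptotics

/-- The Kolmogorov distance `sup_x |P(X ≤ x) - P'(Y ≤ x)|` between real random variables `X` and
`Y`, defined on possibly different probability spaces. -/
noncomputable def kolmogorovDist {Ω Ω' : Type*} [MeasurableSpace Ω] [MeasurableSpace Ω']
    (X : Ω → ℝ) (P : Measure Ω) (Y : Ω' → ℝ) (P' : Measure Ω') : ℝ :=
  ⨆ x : ℝ, |P.real {ω | X ω ≤ x} - P'.real {ω | Y ω ≤ x}|

/-- The number `S` of copies of `Γ` in a graph `G` on `n` labelled vertices, that is, the number of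
(not necessarily induced) subgraphs of `G` isomorphic to `Γ`. -/
noncomputable def subgraphCount {W : Type*} (Γ : SimpleGraph W) (n : ℕ)
    (G : SimpleGraph (Fin n)) : ℝ :=
  (G.copyCount Γ : ℝ)

/-- The normalized subgraph count `F = (S - 𝔼[S]) / √Var[S]`, a random variable on the probability
space of the Erdős–Rényi graph `G(n, p)`. -/
noncomputable def normalizedSubgraphCount {W : Type*} (Γ : SimpleGraph W) (p : unitInterval)
    (n : ℕ) (G : SimpleGraph (Fin n)) : ℝ :=
  (subgraphCount Γ n G -
      ∫ H, subgraphCount Γ n H ∂(SimpleGraph.binomialRandom (Fin n) p)) /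
    √(variance (subgraphCount Γ n) (SimpleGraph.binomialRandom (Fin n) p))

/-! A graph on `n` vertices is a random subset of the `N = n.choose 2` possible edges, and `S`
counts the copies whose edge set lies in that subset. Stein's method on this product space gives the
rate.

For a centred `U` of variance one, the Clark–Ocone formula `exists_clarkOcone` writes `E[U f(U)]` as
half the sum of `E[q_i K_i D_i f(U)]`, where `D_i` is the difference under flipping `i`, `q_i` is
the flip probability, and the kernels `K_i` inherit every uniform bound on `D_i U` and `D_j D_i U`.
With `f` the Stein solution, `P(U ≤ z) - Φ(z)` splits into two errors. One is the fluctuation of `T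
= ∑ q_i K_i D_i U` about its mean 2. The other is the first-order Taylor error of `f`. Since `w
f(w)` and the indicator of `w ≤ z` are monotone, that error is bounded by their increments
(`abs_steinSolution_sub_le`). Resampling is reversible, so these increments turn into expectations
against `T' = ∑ q_i |K_i| D_i U`, which has mean zero. The jump of the indicator therefore costs
nothing extra. Efron–Stein bounds the fluctuations of both `T` and `T'` by first and second
differences of `U`.

Every edge lies in the same number `d` of copies. Hence `|D_i S| ≤ d`, the second differences sum to
at most `2kd` with `k` the number of edges of `Γ`, and covariance with the edge count shows that
`Var S` is at least a constant times `N d²`. The bound becomes a constant over `√N`, of order `1/n`.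
-/

/-! ### Mills ratio bounds and Stein's equation for the normal law. -/

section StandardNormal

open scoped Topology

/-- The density of the standard normal distribution. -/
noncomputable def normalPDF (w : ℝ) : ℝ := gaussianPDFReal 0 1 w

/-- The distribution function of the standard normal distribution. -/
noncomputable def normalCDF (w : ℝ) : ℝ := (gaussianReal 0 1).real (Set.Iic w)

lemma normalPDF_pos (w : ℝ) : 0 < normalPDF w := gaussianPDFReal_pos 0 1 w one_ne_zero

lemma normalPDF_eq (w : ℝ) : normalPDF w = (√(2 * Real.pi))⁻¹ * Real.exp (-w ^ 2 / 2) := by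
  simp [normalPDF, gaussianPDFReal]

lemma normalPDF_neg (w : ℝ) : normalPDF (-w) = normalPDF w := by
  simp [normalPDF_eq]

lemma hasDerivAt_normalPDF (w : ℝ) : HasDerivAt normalPDF (-w * normalPDF w) w := by
  have h : normalPDF = fun w => (√(2 * Real.pi))⁻¹ * Real.exp (-w ^ 2 / 2) :=
    funext normalPDF_eq
  have h1 : HasDerivAt (fun w : ℝ => -w ^ 2 / 2) (-w) w := by
    refine (((hasDerivAt_pow 2 w).neg).div_const 2).congr_deriv ?_
    simp
    ring
  rw [h]
  refine ((h1.exp).const_mul ((√(2 * Real.pi))⁻¹)).congr_deriv ?_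
  ring

lemma integrable_normalPDF : Integrable normalPDF := integrable_gaussianPDFReal 0 1

lemma normalCDF_eq_integral (w : ℝ) : normalCDF w = ∫ t in Set.Iic w, normalPDF t := by
  rw [normalCDF, measureReal_def, gaussianReal_apply_eq_integral 0 one_ne_zero,
    ENNReal.toReal_ofReal]
  · rfl
  · exact setIntegral_nonneg measurableSet_Iic fun t _ => (normalPDF_pos t).le

lemma normalCDF_nonneg (w : ℝ) : 0 ≤ normalCDF w := measureReal_nonneg

lemma normalCDF_le_one (w : ℝ) : normalCDF w ≤ 1 := measureReal_le_one

lemma hasDerivAt_normalCDF (w : ℝ) : HasDerivAt normalCDF (normalPDF w) w := by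
  have h : normalCDF = fun w => (∫ t in (0 : ℝ)..w, normalPDF t) + normalCDF 0 := by
    funext w
    rw [normalCDF_eq_integral, normalCDF_eq_integral,
      ← intervalIntegral.integral_Iic_sub_Iic integrable_normalPDF.integrableOn
        integrable_normalPDF.integrableOn]
    ring
  have hc : Continuous normalPDF :=
    continuous_iff_continuousAt.2 fun t => (hasDerivAt_normalPDF t).continuousAt
  rw [h]
  exact (intervalIntegral.integral_hasDerivAt_right (hc.intervalIntegrable _ _)
    hc.stronglyMeasurable.stronglyMeasurableAtFilter hc.continuousAt).add_const _

lemma normalCDF_neg (w : ℝ) : normalCDF (-w) = 1 - normalCDF w := by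
  have h : (gaussianReal 0 1).real (Set.Ici w) = normalCDF (-w) := by
    have hm : (gaussianReal 0 1).map (fun x : ℝ => -x) = gaussianReal 0 1 := by
      simp [gaussianReal_map_neg]
    conv_lhs => rw [← hm]
    rw [map_measureReal_apply measurable_neg measurableSet_Ici, normalCDF]
    congr 1
    ext x
    simp
  have h2 : (gaussianReal 0 1).real (Set.Ici w) = (gaussianReal 0 1).real (Set.Ioi w) := by
    have := nullSingletonClass_gaussianReal (μ := 0) (v := 1) one_ne_zero
    exact measureReal_congr Ioi_ae_eq_Ici.symm
  rw [← h, h2, ← Set.compl_Iic, probReal_compl_eq_one_sub measurableSet_Iic, normalCDF]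

lemma tendsto_normalPDF_atBot : Tendsto normalPDF atBot (𝓝 0) := by
  have h : normalPDF = fun w => (√(2 * Real.pi))⁻¹ * Real.exp (-w ^ 2 / 2) :=
    funext normalPDF_eq
  rw [h, ← mul_zero ((√(2 * Real.pi))⁻¹)]
  refine (Real.tendsto_exp_atBot.comp ?_).const_mul _
  have h2 : Tendsto (fun w : ℝ => w ^ 2) atBot atTop := 
    ((tendsto_pow_atTop two_ne_zero).comp (tendsto_abs_atBot_atTop (G := ℝ))).congr fun w =>
      sq_abs w
  have h3 := (tendsto_neg_atTop_atBot.comp h2).atBot_div_const (r := 2) two_pos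
  exact h3

lemma tendsto_mul_normalPDF_atBot : Tendsto (fun w => w * normalPDF w) atBot (𝓝 0) := by
  have hb : ∀ᶠ w : ℝ in atBot, |w * normalPDF w| ≤ 2 * (√(2 * Real.pi))⁻¹ * |w|⁻¹ := by
    filter_upwards [eventually_lt_atBot 0] with w hw
    have hw' : 0 < |w| := abs_pos.2 hw.ne
    have h1 : w ^ 2 / 2 ≤ Real.exp (w ^ 2 / 2) := by linarith [Real.add_one_le_exp (w ^ 2 / 2)]
    have h2 : Real.exp (-w ^ 2 / 2) * w ^ 2 ≤ 2 := by
      rw [neg_div, Real.exp_neg]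
      have := Real.exp_pos (w ^ 2 / 2)
      rw [inv_mul_le_iff₀ this]
      linarith
    rw [abs_mul, abs_of_pos (normalPDF_pos w), normalPDF_eq, ← div_eq_mul_inv _ |w|,
      le_div_iff₀ hw']
    have h3 : (0 : ℝ) ≤ (√(2 * Real.pi))⁻¹ := by positivity
    have h4 : |w| * |w| = w ^ 2 := by rw [← sq, sq_abs]
    calc |w| * ((√(2 * Real.pi))⁻¹ * Real.exp (-w ^ 2 / 2)) * |w|
        = (√(2 * Real.pi))⁻¹ * (Real.exp (-w ^ 2 / 2) * (|w| * |w|)) := by ring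
      _ ≤ (√(2 * Real.pi))⁻¹ * 2 := by rw [h4]; gcongr
      _ = _ := by ring
  refine squeeze_zero_norm' hb ?_
  rw [← mul_zero (2 * (√(2 * Real.pi))⁻¹)]
  exact (tendsto_inv_atTop_zero.comp tendsto_abs_atBot_atTop).const_mul _

/-- Upper bound for the Mills ratio. -/
lemma normalPDF_add_mul_normalCDF_nonneg (w : ℝ) : 0 ≤ normalPDF w + w * normalCDF w := by
  rcases le_or_gt 0 w with hw | hw
  · have := normalPDF_pos w
    have := mul_nonneg hw (normalCDF_nonneg w)
    linarith
  have hI : IntegrableOn (fun t => -t * normalPDF t) (Set.Iic w) := by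
    have h := (integrable_mul_exp_neg_mul_sq (b := 1 / 2) (by norm_num)).const_mul
      (-(√(2 * Real.pi))⁻¹)
    refine (h.congr (Eventually.of_forall fun t => ?_)).integrableOn
    simp only [normalPDF_eq]
    ring_nf
  have h1 : ∫ t in Set.Iic w, -t * normalPDF t = normalPDF w - 0 :=
    integral_Iic_of_hasDerivAt_of_tendsto (hasDerivAt_normalPDF w).continuousAt.continuousWithinAt
      (fun x _ => hasDerivAt_normalPDF x) hI tendsto_normalPDF_atBot
  -- Since `-t φ(t)` is the derivative of `φ`, its integral up to `w` is `φ(w)`; on that range `-w ≤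
  -- -t`.
  have h2 : ∫ t in Set.Iic w, -w * normalPDF t ≤ ∫ t in Set.Iic w, -t * normalPDF t := by
    refine setIntegral_mono_on (integrable_normalPDF.integrableOn.const_mul _) hI
      measurableSet_Iic fun t ht => ?_
    have := (normalPDF_pos t).le
    have ht' : t ≤ w := ht
    gcongr
  rw [integral_const_mul, h1, ← normalCDF_eq_integral] at h2
  linarith

/-- Lower bound for the Mills ratio. -/
lemma one_add_sq_mul_normalCDF_add_nonneg (w : ℝ) :
    0 ≤ (1 + w ^ 2) * normalCDF w + w * normalPDF w := by
  have hd : ∀ w : ℝ, HasDerivAt (fun w => (1 + w ^ 2) * normalCDF w + w * normalPDF w)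
      (2 * (normalPDF w + w * normalCDF w)) w := fun w => by
    have h1 := (((hasDerivAt_pow 2 w).const_add 1).mul (hasDerivAt_normalCDF w)).add
      ((hasDerivAt_id w).mul (hasDerivAt_normalPDF w))
    refine h1.congr_deriv ?_
    simp
    ring
  have hmono : Monotone (fun w => (1 + w ^ 2) * normalCDF w + w * normalPDF w) := by
    refine monotone_of_deriv_nonneg (fun w => (hd w).differentiableAt) fun w => ?_
    rw [(hd w).deriv]
    have := normalPDF_add_mul_normalCDF_nonneg w
    linarith
  have hlow : ∀ᶠ w : ℝ in atBot,
      w * normalPDF w ≤ (1 + w ^ 2) * normalCDF w + w * normalPDF w :=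
    Eventually.of_forall fun w => by
      have := mul_nonneg (by positivity : (0 : ℝ) ≤ 1 + w ^ 2) (normalCDF_nonneg w)
      linarith
  -- By monotonicity the value at `w` dominates `v φ(v)` for every `v ≤ w`; let `v → -∞`.
  refine le_of_tendsto tendsto_mul_normalPDF_atBot ?_
  filter_upwards [hlow, eventually_le_atBot w] with v hv hvw
  exact hv.trans (hmono hvw)

/-- The Mills ratio `Φ / φ` of the standard normal distribution. -/
noncomputable def millsRatio (w : ℝ) : ℝ := normalCDF w / normalPDF w

lemma hasDerivAt_millsRatio (w : ℝ) : HasDerivAt millsRatio (1 + w * millsRatio w) w := by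
  have h := (hasDerivAt_normalCDF w).div (hasDerivAt_normalPDF w) (normalPDF_pos w).ne'
  refine h.congr_deriv ?_
  have := (normalPDF_pos w).ne'
  rw [millsRatio]
  field_simp
  ring

lemma neg_one_le_mul_millsRatio (w : ℝ) : -1 ≤ w * millsRatio w := by
  have := normalPDF_add_mul_normalCDF_nonneg w
  rw [millsRatio, ← mul_div_assoc, le_div_iff₀ (normalPDF_pos w)]
  linarith

/-- The numerator of the derivative is exactly the expression in the lower Mills bound. -/
lemma monotone_mul_millsRatio : Monotone fun w => w * millsRatio w := by
  have hd : ∀ w : ℝ, HasDerivAt (fun w => w * millsRatio w)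
      (millsRatio w + w * (1 + w * millsRatio w)) w := fun w => by
    refine ((hasDerivAt_id w).mul (hasDerivAt_millsRatio w)).congr_deriv ?_
    simp
  refine monotone_of_deriv_nonneg (fun w => (hd w).differentiableAt) fun w => ?_
  rw [(hd w).deriv]
  have h := one_add_sq_mul_normalCDF_add_nonneg w
  have hp := normalPDF_pos w
  have : millsRatio w + w * (1 + w * millsRatio w) =
      ((1 + w ^ 2) * normalCDF w + w * normalPDF w) / normalPDF w := by
    rw [millsRatio]
    field_simp
    ring
  rw [this]
  positivity

/-- The solution of Stein's equation `f' w - w * f w = 1[w ≤ z] - Φ z`. -/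
noncomputable def steinSolution (z w : ℝ) : ℝ :=
  if w ≤ z then millsRatio w * (1 - normalCDF z) else millsRatio (-w) * normalCDF z

/-- The derivative of `steinSolution z` away from `z`, extended by Stein's equation. -/
noncomputable def steinDeriv (z w : ℝ) : ℝ :=
  w * steinSolution z w + (if w ≤ z then 1 else 0) - normalCDF z

/-- The two branches of `steinSolution` meet at `z`, which makes it continuous there. -/
lemma millsRatio_matching (z : ℝ) :
    millsRatio z * (1 - normalCDF z) = millsRatio (-z) * normalCDF z := by
  rw [millsRatio, millsRatio, normalCDF_neg, normalPDF_neg]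
  ring

lemma steinSolution_of_ge {z w : ℝ} (h : z ≤ w) :
    steinSolution z w = millsRatio (-w) * normalCDF z := by
  rw [steinSolution]
  split_ifs with h1
  · obtain rfl : w = z := le_antisymm h1 h
    exact millsRatio_matching w
  · rfl

lemma steinSolution_of_le {z w : ℝ} (h : w ≤ z) :
    steinSolution z w = millsRatio w * (1 - normalCDF z) := if_pos h

/-- Each branch is a nonnegative multiple of `w * millsRatio w`, reflected twice on the right, and
the branches are glued at `z`. This monotonicity replaces bounds on a second derivative, which fails
to exist at the jump. -/
lemma monotone_mul_steinSolution (z : ℝ) : Monotone fun w => w * steinSolution z w := by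
  have h0 := normalCDF_nonneg z
  have h1 := normalCDF_le_one z
  have hL : ∀ v w, v ≤ w → w ≤ z → v * steinSolution z v ≤ w * steinSolution z w := by
    intro v w hvw hw
    rw [steinSolution_of_le hw, steinSolution_of_le (hvw.trans hw), ← mul_assoc, ← mul_assoc]
    exact mul_le_mul_of_nonneg_right (monotone_mul_millsRatio hvw) (by linarith)
  have hR : ∀ v w, v ≤ w → z ≤ v → v * steinSolution z v ≤ w * steinSolution z w := by
    intro v w hvw hv
    rw [steinSolution_of_ge hv, steinSolution_of_ge (hv.trans hvw), ← mul_assoc, ← mul_assoc]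
    refine mul_le_mul_of_nonneg_right ?_ h0
    have := monotone_mul_millsRatio (neg_le_neg hvw)
    simp only at this
    linarith
  intro v w hvw
  rcases le_total w z with hw | hw
  · exact hL v w hvw hw
  rcases le_total v z with hv | hv
  · exact (hL v z hv le_rfl).trans (hR z w hw le_rfl)
  · exact hR v w hvw hv

/-- By monotonicity only `w ≥ z` matters, where the upper Mills bound at `-w` applies. -/
lemma mul_steinSolution_le (z w : ℝ) : w * steinSolution z w ≤ normalCDF z := by
  have h : ∀ w, z ≤ w → w * steinSolution z w ≤ normalCDF z := fun w hw => by
    rw [steinSolution_of_ge hw]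
    nlinarith [neg_one_le_mul_millsRatio (-w), normalCDF_nonneg z]
  exact (monotone_mul_steinSolution z (le_max_right z w)).trans (h _ (le_max_left z w))

lemma le_mul_steinSolution (z w : ℝ) : normalCDF z - 1 ≤ w * steinSolution z w := by
  have h : ∀ w, w ≤ z → normalCDF z - 1 ≤ w * steinSolution z w := fun w hw => by
    rw [steinSolution_of_le hw]
    nlinarith [neg_one_le_mul_millsRatio w, normalCDF_le_one z]
  exact (h _ (min_le_left z w)).trans (monotone_mul_steinSolution z (min_le_right z w))

lemma abs_mul_steinSolution_le (z w : ℝ) : |w * steinSolution z w| ≤ 1 := by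
  rw [abs_le]
  constructor <;> linarith [mul_steinSolution_le z w, le_mul_steinSolution z w,
    normalCDF_nonneg z, normalCDF_le_one z]

lemma abs_steinDeriv_le (z w : ℝ) : |steinDeriv z w| ≤ 1 := by
  have h0 := mul_steinSolution_le z w
  have h1 := le_mul_steinSolution z w
  rw [steinDeriv, abs_le]
  split_ifs <;> constructor <;> linarith [normalCDF_nonneg z, normalCDF_le_one z]

lemma continuous_millsRatio : Continuous millsRatio :=
  continuous_iff_continuousAt.2 fun w => (hasDerivAt_millsRatio w).continuousAt

lemma continuous_steinSolution (z : ℝ) : Continuous (steinSolution z) := by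
  refine Continuous.if_le (continuous_millsRatio.mul continuous_const)
    ((continuous_millsRatio.comp continuous_neg).mul continuous_const) continuous_id
    continuous_const ?_
  intro x hx
  subst hx
  exact millsRatio_matching _

lemma hasDerivAt_steinSolution {z w : ℝ} (h : w ≠ z) :
    HasDerivAt (steinSolution z) (steinDeriv z w) w := by
  rcases lt_or_gt_of_ne h with h | h
  · have h1 : steinSolution z =ᶠ[𝓝 w] fun w => millsRatio w * (1 - normalCDF z) := by
      filter_upwards [Iio_mem_nhds h] with v hv
      exact steinSolution_of_le (le_of_lt hv)
    refine HasDerivAt.congr_of_eventuallyEq ?_ h1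
    refine ((hasDerivAt_millsRatio w).mul_const (1 - normalCDF z)).congr_deriv ?_
    rw [steinDeriv, if_pos h.le, steinSolution_of_le h.le]
    ring
  · have h1 : steinSolution z =ᶠ[𝓝 w] fun w => millsRatio (-w) * normalCDF z := by
      filter_upwards [Ioi_mem_nhds h] with v hv
      exact steinSolution_of_ge (le_of_lt hv)
    refine HasDerivAt.congr_of_eventuallyEq ?_ h1
    refine (((hasDerivAt_millsRatio (-w)).comp w (hasDerivAt_neg w)).mul_const
      (normalCDF z)).congr_deriv ?_
    rw [steinDeriv, if_neg (not_le.2 h), steinSolution_of_ge h.le]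
    ring

/-- The mean value inequality for a function that is differentiable off a single point. -/
lemma sub_le_mul_sub_of_hasDerivAt_off_point {f f' : ℝ → ℝ} {z C a b : ℝ} (hf : Continuous f)
    (hd : ∀ t, t ≠ z → HasDerivAt f (f' t) t) (hab : a ≤ b)
    (hC : ∀ t ∈ Set.Icc a b, f' t ≤ C) : f b - f a ≤ C * (b - a) := by
  have key : ∀ a' b', a ≤ a' → a' ≤ b' → b' ≤ b → z ∉ Set.Ioo a' b' →
      f b' - f a' ≤ C * (b' - a') := by
    intro a' b' h1 h2 h3 hz
    have hne : ∀ t ∈ interior (Set.Icc a' b'), t ≠ z := by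
      rintro t ht rfl
      rw [interior_Icc] at ht
      exact hz ht
    refine (convex_Icc a' b').image_sub_le_mul_sub_of_deriv_le hf.continuousOn
      (fun t ht => (hd t (hne t ht)).differentiableAt.differentiableWithinAt)
      (fun t ht => ?_) a' (Set.left_mem_Icc.2 h2) b' (Set.right_mem_Icc.2 h2) h2
    rw [(hd t (hne t ht)).deriv]
    have := interior_subset ht
    exact hC t ⟨h1.trans this.1, this.2.trans h3⟩
  by_cases hz : z ∈ Set.Ioo a b
  · have h1 := key a z le_rfl hz.1.le hz.2.le (fun h => lt_irrefl _ h.2)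
    have h2 := key z b hz.1.le hz.2.le le_rfl (fun h => lt_irrefl _ h.1)
    linarith
  · exact key a b le_rfl hab le_rfl hz

/-- The error of the first order expansion of `steinSolution z` is controlled by the increments of
two monotone functions. -/
lemma abs_steinSolution_sub_le (z w v : ℝ) :
    |steinSolution z w - steinSolution z v - (w - v) * steinDeriv z w| ≤
      (w - v) * (w * steinSolution z w - v * steinSolution z v) +
      (w - v) * ((if v ≤ z then 1 else 0) - (if w ≤ z then 1 else 0)) := by
  set g : ℝ → ℝ := fun w => w * steinSolution z w with hg
  set h : ℝ → ℝ := fun w => if w ≤ z then 1 else 0 with hh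
  have hgm : Monotone g := monotone_mul_steinSolution z
  have hhm : Antitone h := by
    intro a b hab
    simp only [hh]
    split_ifs <;> linarith
  have hs : ∀ t, steinDeriv z t = g t + h t - normalCDF z := fun t => rfl
  -- The derivative is `g + h - Φ(z)` with `g` increasing and `h` decreasing, so on `[a, b]` it is
  -- at most `g b + h a - Φ(z)` and at least `g a + h b - Φ(z)`.
  have up : ∀ a b, a ≤ b → steinSolution z b - steinSolution z a ≤
      (g b + h a - normalCDF z) * (b - a) := fun a b hab =>
    sub_le_mul_sub_of_hasDerivAt_off_point (continuous_steinSolution z)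
      (fun t ht => hasDerivAt_steinSolution ht) hab fun t ht => by
        rw [hs]
        linarith [hgm ht.2, hhm ht.1]
  have low : ∀ a b, a ≤ b → (g a + h b - normalCDF z) * (b - a) ≤
      steinSolution z b - steinSolution z a := fun a b hab => by
    have := sub_le_mul_sub_of_hasDerivAt_off_point (continuous_steinSolution z).neg
      (C := -(g a + h b - normalCDF z))
      (fun t ht => (hasDerivAt_steinSolution ht).neg) hab fun t ht => by
        rw [hs]
        linarith [hgm ht.1, hhm ht.2]
    simp only [Pi.neg_apply] at this
    linarith
  change _ ≤ (w - v) * (g w - g v) + (w - v) * (h v - h w)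
  rw [hs, abs_le]
  rcases le_total v w with hvw | hvw
  · have h1 := up v w hvw
    have h2 := low v w hvw
    have h3 := mul_nonneg (sub_nonneg.2 hvw) (sub_nonneg.2 (hgm hvw))
    have h4 := mul_nonneg (sub_nonneg.2 hvw) (sub_nonneg.2 (hhm hvw))
    constructor <;> nlinarith
  · have h1 := up w v hvw
    have h2 := low w v hvw
    have h3 := mul_nonneg (sub_nonneg.2 hvw) (sub_nonneg.2 (hgm hvw))
    have h4 := mul_nonneg (sub_nonneg.2 hvw) (sub_nonneg.2 (hhm hvw))
    constructor <;> nlinarith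

end StandardNormal

/-! ### Discrete calculus on the cube: flips, differences, averages. -/

namespace BernoulliCube

variable {ι : Type*} {p : ℝ}

section Flip

variable [DecidableEq ι]

/-- The subset `x` with the membership of `i` switched. -/
def flip (i : ι) (x : Finset ι) : Finset ι := symmDiff x {i}

lemma flip_flip (i : ι) (x : Finset ι) : flip i (flip i x) = x :=
  symmDiff_symmDiff_cancel_right _ _

lemma flip_comm (i j : ι) (x : Finset ι) : flip i (flip j x) = flip j (flip i x) :=
  symmDiff_right_comm _ _ _

lemma mem_flip_self {i : ι} {x : Finset ι} : i ∈ flip i x ↔ i ∉ x := by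
  simp [flip, Finset.mem_symmDiff]

lemma mem_flip_of_ne {i j : ι} (h : j ≠ i) {x : Finset ι} : j ∈ flip i x ↔ j ∈ x := by
  simp [flip, Finset.mem_symmDiff, h]

lemma flip_of_notMem {i : ι} {x : Finset ι} (h : i ∉ x) : flip i x = insert i x := by
  ext j
  by_cases hj : j = i
  · subst hj; simp [mem_flip_self, h]
  · simp [mem_flip_of_ne hj, hj]

/-- A function that is invariant under all flips is constant. -/
lemma eq_of_flip_invariant {U : Finset ι → ℝ} (h : ∀ i x, U (flip i x) = U x) (x : Finset ι) :
    U x = U ∅ := by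
  induction x using Finset.induction_on with
  | empty => rfl
  | insert i x hi ih => rw [← flip_of_notMem hi, h, ih]

/-- The probability that resampling the membership of `i` switches it. -/
noncomputable def flipProb (p : ℝ) (i : ι) (x : Finset ι) : ℝ := if i ∈ x then 1 - p else p

lemma flipProb_flip_self (i : ι) (x : Finset ι) :
    flipProb p i (flip i x) = 1 - flipProb p i x := by
  simp only [flipProb, mem_flip_self]
  split_ifs <;> ring

lemma flipProb_flip_of_ne {i j : ι} (h : j ≠ i) (x : Finset ι) :
    flipProb p j (flip i x) = flipProb p j x := by
  simp only [flipProb, mem_flip_of_ne h]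

lemma flipProb_nonneg (h0 : 0 ≤ p) (h1 : p ≤ 1) (i : ι) (x : Finset ι) : 0 ≤ flipProb p i x := by
  rw [flipProb]; split_ifs <;> linarith

lemma flipProb_le_one (h0 : 0 ≤ p) (h1 : p ≤ 1) (i : ι) (x : Finset ι) : flipProb p i x ≤ 1 := by
  rw [flipProb]; split_ifs <;> linarith

/-- The discrete derivative in direction `i`. -/
def diff (i : ι) (U : Finset ι → ℝ) (x : Finset ι) : ℝ := U x - U (flip i x)

lemma diff_flip_self (i : ι) (U : Finset ι → ℝ) (x : Finset ι) :
    diff i U (flip i x) = -diff i U x := by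
  simp only [diff, flip_flip]; ring

lemma diff_comm (i j : ι) (U : Finset ι → ℝ) (x : Finset ι) :
    diff i (diff j U) x = diff j (diff i U) x := by
  simp only [diff, flip_comm i j]; ring

lemma diff_eq_zero {i : ι} {U : Finset ι → ℝ} (h : ∀ x, U (flip i x) = U x) (x : Finset ι) :
    diff i U x = 0 := by
  rw [diff, h, sub_self]

/-- Averaging over the membership of `i`. -/
noncomputable def average (p : ℝ) (i : ι) (U : Finset ι → ℝ) (x : Finset ι) : ℝ :=
  U x - flipProb p i x * diff i U x

lemma average_flip_self (i : ι) (U : Finset ι → ℝ) (x : Finset ι) :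
    average p i U (flip i x) = average p i U x := by
  simp only [average, flipProb_flip_self, diff_flip_self]
  rw [diff]; ring

lemma average_flip_of_ne {i j : ι} (h : i ≠ j) (U : Finset ι → ℝ) (x : Finset ι) :
    average p i U (flip j x) = average p i (fun y => U (flip j y)) x := by
  simp only [average, flipProb_flip_of_ne h, diff, flip_comm i j]

lemma diff_average_of_ne {i j : ι} (h : j ≠ i) (U : Finset ι → ℝ) :
    diff j (average p i U) = average p i (diff j U) := by
  funext x
  rw [diff, average_flip_of_ne h.symm]
  simp only [average, diff, flip_comm j i]
  ring

lemma abs_average_le (h0 : 0 ≤ p) (h1 : p ≤ 1) (i : ι) {U : Finset ι → ℝ} {c : ℝ}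
    (h : ∀ x, |U x| ≤ c) (x : Finset ι) : |average p i U x| ≤ c := by
  have e : average p i U x = (1 - flipProb p i x) * U x + flipProb p i x * U (flip i x) := by
    simp only [average, diff]; ring
  have hq0 := flipProb_nonneg h0 h1 i x
  have hq1 := sub_nonneg.2 (flipProb_le_one h0 h1 i x)
  rw [e]
  calc _ ≤ |(1 - flipProb p i x) * U x| + |flipProb p i x * U (flip i x)| := abs_add_le _ _
    _ = (1 - flipProb p i x) * |U x| + flipProb p i x * |U (flip i x)| := by
        rw [abs_mul, abs_mul, abs_of_nonneg hq0, abs_of_nonneg hq1]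
    _ ≤ (1 - flipProb p i x) * c + flipProb p i x * c := by
        gcongr <;> exact h _
    _ = c := by ring

end Flip

/-! ### Expectation under the product measure. -/

section Expect

variable [Fintype ι]

/-- The weight of `x` under the law of a random subset of `ι` that contains each element
independently with probability `p`. -/
noncomputable def weight (p : ℝ) (x : Finset ι) : ℝ :=
  p ^ x.card * (1 - p) ^ (Fintype.card ι - x.card)

/-- The expectation of a function of a random subset of `ι`. -/
noncomputable def expect (p : ℝ) (U : Finset ι → ℝ) : ℝ := ∑ x, weight p x * U x

lemma weight_nonneg (h0 : 0 ≤ p) (h1 : p ≤ 1) (x : Finset ι) : 0 ≤ weight p x :=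
  mul_nonneg (pow_nonneg h0 _) (pow_nonneg (sub_nonneg.2 h1) _)

lemma sum_weight (p : ℝ) : ∑ x : Finset ι, weight p x = 1 := by
  simp only [weight, Fintype.sum_pow_mul_eq_add_pow, add_sub_cancel, one_pow]

lemma expect_const (c : ℝ) : expect p (fun _ : Finset ι => c) = c := by
  rw [expect, ← Finset.sum_mul, sum_weight, one_mul]

lemma expect_add (U V : Finset ι → ℝ) :
    expect p (fun x => U x + V x) = expect p U + expect p V := by
  simp only [expect, mul_add, Finset.sum_add_distrib]

lemma expect_sub (U V : Finset ι → ℝ) :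
    expect p (fun x => U x - V x) = expect p U - expect p V := by
  simp only [expect, mul_sub, Finset.sum_sub_distrib]

lemma expect_const_mul (c : ℝ) (U : Finset ι → ℝ) :
    expect p (fun x => c * U x) = c * expect p U := by
  simp only [expect, Finset.mul_sum]
  exact Finset.sum_congr rfl fun x _ => by ring

lemma expect_sum {α : Type*} (s : Finset α) (U : α → Finset ι → ℝ) :
    expect p (fun x => ∑ a ∈ s, U a x) = ∑ a ∈ s, expect p (U a) := by
  simp only [expect, Finset.mul_sum]
  exact Finset.sum_comm

lemma expect_mono (h0 : 0 ≤ p) (h1 : p ≤ 1) {U V : Finset ι → ℝ} (h : ∀ x, U x ≤ V x) :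
    expect p U ≤ expect p V :=
  Finset.sum_le_sum fun x _ => mul_le_mul_of_nonneg_left (h x) (weight_nonneg h0 h1 x)

lemma expect_nonneg (h0 : 0 ≤ p) (h1 : p ≤ 1) {U : Finset ι → ℝ} (h : ∀ x, 0 ≤ U x) :
    0 ≤ expect p U :=
  Finset.sum_nonneg fun x _ => mul_nonneg (weight_nonneg h0 h1 x) (h x)

lemma abs_expect_le (h0 : 0 ≤ p) (h1 : p ≤ 1) (U : Finset ι → ℝ) :
    |expect p U| ≤ expect p fun x => |U x| := by
  refine (Finset.abs_sum_le_sum_abs _ _).trans (Finset.sum_le_sum fun x _ => ?_)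
  rw [abs_mul, abs_of_nonneg (weight_nonneg h0 h1 x)]

lemma sq_expect_mul_le (h0 : 0 ≤ p) (h1 : p ≤ 1) (U V : Finset ι → ℝ) :
    expect p (fun x => U x * V x) ^ 2 ≤
      expect p (fun x => U x ^ 2) * expect p (fun x => V x ^ 2) := by
  have h := Finset.sum_mul_sq_le_sq_mul_sq Finset.univ
    (fun x => √(weight p x) * U x) (fun x => √(weight p x) * V x)
  have e : ∀ x : Finset ι, √(weight p x) * √(weight p x) = weight p x := fun x =>
    Real.mul_self_sqrt (weight_nonneg h0 h1 x)
  have e1 : ∀ (x : Finset ι) (a b : ℝ),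
      √(weight p x) * a * (√(weight p x) * b) = weight p x * (a * b) := fun x a b => by
    linear_combination a * b * e x
  have e2 : ∀ (x : Finset ι) (a : ℝ), (√(weight p x) * a) ^ 2 = weight p x * a ^ 2 :=
    fun x a => by linear_combination a ^ 2 * e x
  simp only [e1, e2] at h
  exact h

lemma expect_abs_le_sqrt (h0 : 0 ≤ p) (h1 : p ≤ 1) (U : Finset ι → ℝ) :
    expect p (fun x => |U x|) ≤ √(expect p fun x => U x ^ 2) := by
  have h := sq_expect_mul_le h0 h1 (fun x => |U x|) (fun _ => 1)
  simp only [mul_one, one_pow, sq_abs, expect_const] at h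
  exact Real.le_sqrt_of_sq_le h

end Expect

/-! ### Reversibility, the Clark–Ocone formula and the Efron–Stein inequality. -/

variable [Fintype ι] [DecidableEq ι]

/-- Detailed balance: both sides are `p (1 - p)` times the weight of the coordinates other than `i`.
-/
lemma weight_mul_flipProb_flip (i : ι) (x : Finset ι) :
    weight p (flip i x) * flipProb p i (flip i x) = weight p x * flipProb p i x := by
  have key : ∀ x : Finset ι, i ∉ x →
      weight p (flip i x) * flipProb p i (flip i x) = weight p x * flipProb p i x := by
    intro x hx
    rw [flipProb_flip_self, flipProb, if_neg hx, flip_of_notMem hx, weight, weight,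
      Finset.card_insert_of_notMem hx]
    have hlt : x.card < Fintype.card ι := Finset.card_lt_univ_of_notMem hx
    obtain ⟨m, hm⟩ : ∃ m, Fintype.card ι - x.card = m + 1 :=
      ⟨Fintype.card ι - x.card - 1, by omega⟩
    rw [show Fintype.card ι - (x.card + 1) = m by omega, hm]
    ring
  by_cases hx : i ∈ x
  · have h := key (flip i x) (by simpa [mem_flip_self] using hx)
    rw [flip_flip] at h
    exact h.symm
  · exact key x hx

/-- Reversibility of resampling. -/
lemma expect_flipProb_mul_flip (i : ι) (U : Finset ι → ℝ) :
    expect p (fun x => flipProb p i x * U (flip i x)) =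
      expect p (fun x => flipProb p i x * U x) := by
  rw [expect, expect]
  refine Fintype.sum_equiv (Function.Involutive.toPerm (flip i) (flip_flip i)) _ _ fun x => ?_
  change _ = weight p (flip i x) * (flipProb p i (flip i x) * U (flip i x))
  rw [← mul_assoc, ← mul_assoc, weight_mul_flipProb_flip]

/-- Integration by parts: `diff i U` is odd under the flip, which preserves the expectation weighted
by `flipProb`, so `V` may be antisymmetrized. -/
lemma expect_flipProb_mul_diff_mul (i : ι) (U V : Finset ι → ℝ) :
    expect p (fun x => flipProb p i x * (diff i U x * V x)) =
      1 / 2 * expect p (fun x => flipProb p i x * (diff i U x * diff i V x)) := by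
  have h := expect_flipProb_mul_flip (p := p) i fun x => diff i U x * V x
  have e : (fun x => flipProb p i x * (diff i U x * diff i V x)) = fun x =>
      flipProb p i x * (diff i U x * V x) +
        flipProb p i x * (diff i U (flip i x) * V (flip i x)) := by
    funext x
    rw [diff_flip_self, diff, diff]; ring
  rw [e, expect_add, h]
  ring

lemma expect_average (i : ι) (U : Finset ι → ℝ) : expect p (average p i U) = expect p U := by
  have h := expect_flipProb_mul_diff_mul (p := p) i U fun _ => 1
  have e : (fun x => flipProb p i x * (diff i U x * diff i (fun _ => 1) x)) = fun _ => 0 := by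
    funext x
    simp [diff]
  rw [e, expect_const] at h
  simp only [mul_one, mul_zero] at h
  change expect p (fun x => U x - flipProb p i x * diff i U x) = _
  rw [expect_sub, h, sub_zero]

/-- A partial Clark–Ocone formula: `U` minus its average over the coordinates in `S` is
represented through kernels `K i`, `i ∈ S`, that inherit the bounds of the discrete derivatives
of `U`. -/
lemma exists_partial_clarkOcone (h0 : 0 ≤ p) (h1 : p ≤ 1) (S : Finset ι) :
    ∀ U : Finset ι → ℝ, ∃ (R : Finset ι → ℝ) (K : ι → Finset ι → ℝ),
      (∀ V : Finset ι → ℝ, expect p (fun x => (U x - R x) * V x) =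
        1 / 2 * ∑ i ∈ S, expect p fun x => flipProb p i x * (K i x * diff i V x)) ∧
      (∀ i ∈ S, ∀ x, R (flip i x) = R x) ∧
      (∀ i, (∀ x, U (flip i x) = U x) → ∀ x, R (flip i x) = R x) ∧
      expect p R = expect p U ∧
      (∀ i ∈ S, ∀ x, K i (flip i x) = -K i x) ∧
      (∀ i ∈ S, ∀ c, (∀ x, |diff i U x| ≤ c) → ∀ x, |K i x| ≤ c) ∧
      (∀ i ∈ S, ∀ j c, (∀ x, |diff j (diff i U) x| ≤ c) → ∀ x, |diff j (K i) x| ≤ c) := by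
  induction S using Finset.induction_on with
  | empty => exact fun U => ⟨U, fun _ _ => 0, by simp [expect]⟩
  | insert k S hk ih =>
    intro U
    -- Telescoping: `U - average p k U` is `flipProb` times `diff k U` and contributes the kernel
    -- `diff k U`. The other kernels come from the averaged function; averaging over `k` commutes
    -- with the other differences and does not increase uniform bounds.
    obtain ⟨R, K, hrep, hS, hinv, hE, hanti, hK, hDK⟩ := ih (average p k U)
    have hne : ∀ i ∈ S, i ≠ k := fun i hi h => hk (h ▸ hi)
    refine ⟨R, Function.update K k (diff k U), fun V => ?_, ?_, fun i hi => ?_, ?_, ?_, ?_, ?_⟩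
    · rw [Finset.sum_insert hk, Function.update_self, mul_add, ← expect_flipProb_mul_diff_mul]
      have e : ∑ i ∈ S, expect p (fun x =>
          flipProb p i x * (Function.update K k (diff k U) i x * diff i V x)) =
          ∑ i ∈ S, expect p fun x => flipProb p i x * (K i x * diff i V x) :=
        Finset.sum_congr rfl fun i hi => by rw [Function.update_of_ne (hne i hi)]
      rw [e, ← hrep V, ← expect_add]
      congr 1
      funext x
      rw [average]
      ring
    · intro i hi
      rcases Finset.mem_insert.1 hi with rfl | hi
      · exact hinv i (average_flip_self i U)
      · exact hS i hi
    · refine hinv i fun x => ?_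
      by_cases hik : i = k
      · rw [hik]; exact average_flip_self k U x
      · rw [average_flip_of_ne (Ne.symm hik)]
        simp only [hi]
    · rw [hE, expect_average]
    · intro i hi
      rcases Finset.mem_insert.1 hi with rfl | hi
      · rw [Function.update_self]; exact diff_flip_self i U
      · rw [Function.update_of_ne (hne i hi)]; exact hanti i hi
    · intro i hi c hc
      rcases Finset.mem_insert.1 hi with rfl | hi
      · rw [Function.update_self]; exact hc
      · rw [Function.update_of_ne (hne i hi)]
        refine hK i hi c ?_
        rw [diff_average_of_ne (hne i hi)]
        exact abs_average_le h0 h1 k hc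
    · intro i hi j c hc
      rcases Finset.mem_insert.1 hi with rfl | hi
      · rw [Function.update_self]; exact hc
      · rw [Function.update_of_ne (hne i hi)]
        refine hDK i hi j c ?_
        rw [diff_average_of_ne (hne i hi)]
        by_cases hj : j = k
        · intro x
          rw [hj, diff_eq_zero (average_flip_self k _), abs_zero]
          exact (abs_nonneg _).trans (hc x)
        · rw [diff_average_of_ne hj]
          exact abs_average_le h0 h1 k hc

/-- The Clark–Ocone formula on the discrete cube. -/
lemma exists_clarkOcone (h0 : 0 ≤ p) (h1 : p ≤ 1) (U : Finset ι → ℝ) :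
    ∃ K : ι → Finset ι → ℝ,
      (∀ V : Finset ι → ℝ, expect p (fun x => (U x - expect p U) * V x) =
        1 / 2 * ∑ i, expect p fun x => flipProb p i x * (K i x * diff i V x)) ∧
      (∀ i x, K i (flip i x) = -K i x) ∧
      (∀ i c, (∀ x, |diff i U x| ≤ c) → ∀ x, |K i x| ≤ c) ∧
      (∀ i j c, (∀ x, |diff j (diff i U) x| ≤ c) → ∀ x, |diff j (K i) x| ≤ c) := by
  obtain ⟨R, K, hrep, hS, -, hE, hanti, hK, hDK⟩ :=
    exists_partial_clarkOcone h0 h1 Finset.univ U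
  -- Averaging over all coordinates leaves a constant, which must be the mean.
  have hR : ∀ x, R x = expect p U := by
    have hc := eq_of_flip_invariant fun i x => hS i (Finset.mem_univ i) x
    have : expect p R = R ∅ := by
      rw [show R = fun _ => R ∅ from funext hc, expect_const]
    intro x
    rw [hc, ← this, hE]
  simp only [hR] at hrep
  exact ⟨K, hrep, fun i => hanti i (Finset.mem_univ i), fun i => hK i (Finset.mem_univ i),
    fun i => hDK i (Finset.mem_univ i)⟩

/-- The Efron–Stein inequality for functions with bounded differences. -/
lemma variance_le_of_abs_diff_le (h0 : 0 ≤ p) (h1 : p ≤ 1) {U : Finset ι → ℝ} {c : ℝ}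
    (h : ∀ i x, |diff i U x| ≤ c) :
    expect p (fun x => (U x - expect p U) ^ 2) ≤ 1 / 2 * (Fintype.card ι * c ^ 2) := by
  obtain ⟨K, hrep, -, hK, -⟩ := exists_clarkOcone h0 h1 U
  have h2 := hrep fun x => U x - expect p U
  simp only [← sq] at h2
  rw [h2]
  refine mul_le_mul_of_nonneg_left ?_ (by norm_num)
  rw [← nsmul_eq_mul, ← Finset.card_univ, ← Finset.sum_const]
  refine Finset.sum_le_sum fun i _ => ?_
  rw [← expect_const (p := p) (ι := ι) (c ^ 2)]
  refine expect_mono h0 h1 fun x => ?_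
  have e : diff i (fun x => U x - expect p U) x = diff i U x := by simp only [diff]; ring
  rw [e]
  refine (le_abs_self _).trans ?_
  rw [abs_mul, abs_mul, abs_of_nonneg (flipProb_nonneg h0 h1 i x), sq]
  have hc : 0 ≤ c := (abs_nonneg _).trans (h i x)
  calc _ ≤ 1 * (c * c) := by
        gcongr
        · exact flipProb_le_one h0 h1 i x
        · exact hK i c (h i) x
        · exact h i x
    _ = c * c := one_mul _

lemma expect_abs_sub_le (h0 : 0 ≤ p) (h1 : p ≤ 1) {U : Finset ι → ℝ} {c : ℝ} (hc : 0 ≤ c)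
    (h : ∀ i x, |diff i U x| ≤ c) :
    expect p (fun x => |U x - expect p U|) ≤ √(Fintype.card ι) * c := by
  refine (expect_abs_le_sqrt h0 h1 _).trans ?_
  refine Real.sqrt_le_iff.2 ⟨by positivity, (variance_le_of_abs_diff_le h0 h1 h).trans ?_⟩
  rw [mul_pow, Real.sq_sqrt (Nat.cast_nonneg _)]
  have : 0 ≤ (Fintype.card ι : ℝ) * c ^ 2 := by positivity
  linarith

/-! ### Stein's method on the cube. -/

/-- The sum over `i` of the derivatives of `U` weighted by the family `K` and the probabilities that
resampling switches `i`. -/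
noncomputable def gammaSum (p : ℝ) (K : ι → Finset ι → ℝ) (U : Finset ι → ℝ) (x : Finset ι) : ℝ :=
  ∑ i, flipProb p i x * (K i x * diff i U x)

/-- In the `j`-th summand a flip turns `flipProb` into its complement, so the difference is a convex
combination of terms of size at most `a ^ 2`. In the others `flipProb` is unchanged and the product
rule gives `2 * a * b i j`. No parity of `K` enters, so the bound serves both the Clark–Ocone
kernels and their absolute values. -/
lemma abs_diff_gammaSum_le (h0 : 0 ≤ p) (h1 : p ≤ 1) {K : ι → Finset ι → ℝ} {U : Finset ι → ℝ}
    {a β : ℝ} {b : ι → ι → ℝ} (ha : ∀ i x, |diff i U x| ≤ a)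
    (hb : ∀ i j, i ≠ j → ∀ x, |diff j (diff i U) x| ≤ b i j)
    (hβ : ∀ j, ∑ i ∈ Finset.univ.erase j, b i j ≤ β)
    (hK : ∀ i x, |K i x| ≤ a) (hDK : ∀ i j, i ≠ j → ∀ x, |diff j (K i) x| ≤ b i j)
    (j : ι) (x : Finset ι) : |diff j (gammaSum p K U) x| ≤ a ^ 2 + 2 * a * β := by
  have ha0 : 0 ≤ a := (abs_nonneg _).trans (ha j x)
  have e : diff j (gammaSum p K U) x =
      diff j (fun x => flipProb p j x * (K j x * diff j U x)) x +
        ∑ i ∈ Finset.univ.erase j,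
          diff j (fun x => flipProb p i x * (K i x * diff i U x)) x := by
    rw [Finset.add_sum_erase Finset.univ
      (fun i => diff j (fun x => flipProb p i x * (K i x * diff i U x)) x) (Finset.mem_univ j)]
    simp only [diff, gammaSum, Finset.sum_sub_distrib]
  have hself : |diff j (fun x => flipProb p j x * (K j x * diff j U x)) x| ≤ a ^ 2 := by
    have e1 : diff j (fun x => flipProb p j x * (K j x * diff j U x)) x =
        flipProb p j x * (K j x * diff j U x) +
          (1 - flipProb p j x) * (K j (flip j x) * diff j U x) := by
      rw [diff, flipProb_flip_self, diff_flip_self]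
      ring
    have hq0 := flipProb_nonneg h0 h1 j x
    have hq1 := sub_nonneg.2 (flipProb_le_one h0 h1 j x)
    rw [e1]
    refine (abs_add_le _ _).trans ?_
    simp only [abs_mul, abs_of_nonneg hq0, abs_of_nonneg hq1]
    calc _ ≤ flipProb p j x * (a * a) + (1 - flipProb p j x) * (a * a) := by
          gcongr
          · exact hK j x
          · exact ha j x
          · exact hK j _
          · exact ha j x
      _ = a ^ 2 := by ring
  have hoff : ∀ i ∈ Finset.univ.erase j,
      |diff j (fun x => flipProb p i x * (K i x * diff i U x)) x| ≤ 2 * a * b i j := by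
    intro i hi
    have hij : i ≠ j := (Finset.mem_erase.1 hi).1
    have e1 : diff j (fun x => flipProb p i x * (K i x * diff i U x)) x =
        flipProb p i x * (diff j (K i) x * diff i U x +
          K i (flip j x) * diff j (diff i U) x) := by
      rw [diff, flipProb_flip_of_ne hij]
      simp only [diff]
      ring
    have hq0 := flipProb_nonneg h0 h1 i x
    have hb0 : 0 ≤ b i j := (abs_nonneg _).trans (hb i j hij x)
    rw [e1, abs_mul, abs_of_nonneg hq0]
    calc _ ≤ 1 * (b i j * a + a * b i j) := by
          gcongr
          · exact flipProb_le_one h0 h1 i x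
          · refine (abs_add_le _ _).trans ?_
            rw [abs_mul, abs_mul]
            gcongr
            · exact hDK i j hij x
            · exact ha i x
            · exact hK i _
            · exact hb i j hij x
      _ = 2 * a * b i j := by ring
  rw [e]
  refine (abs_add_le _ _).trans (add_le_add hself ?_)
  refine (Finset.abs_sum_le_sum_abs _ _).trans ((Finset.sum_le_sum hoff).trans ?_)
  rw [← Finset.mul_sum]
  exact mul_le_mul_of_nonneg_left (hβ j) (by positivity)

/-- For a symmetric family `M`, the sum of `M` against the derivatives of `V ∘ U` is an expectation
of a single sum. -/
lemma sum_expect_mul_diff_mul (M : ι → Finset ι → ℝ) (hM : ∀ i x, M i (flip i x) = M i x)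
    (U V : Finset ι → ℝ) :
    ∑ i, expect p (fun x => flipProb p i x * (M i x * (diff i U x * diff i V x))) =
      2 * expect p (fun x => gammaSum p M U x * V x) := by
  simp only [gammaSum, Finset.sum_mul, expect_sum, Finset.mul_sum]
  refine Finset.sum_congr rfl fun i _ => ?_
  have h := expect_flipProb_mul_flip (p := p) i fun x => M i x * (diff i U x * V x)
  have e : (fun x => flipProb p i x * (M i x * (diff i U x * diff i V x))) = fun x =>
      flipProb p i x * (M i x * (diff i U x * V x)) +
        flipProb p i x * (M i (flip i x) * (diff i U (flip i x) * V (flip i x))) := by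
    funext x
    rw [hM, diff_flip_self]
    simp only [diff]
    ring
  rw [e, expect_add, h, ← two_mul]
  congr 2
  funext x
  ring

/-- **A Berry–Esseen bound on the discrete cube** in terms of first and second order
differences. -/
theorem abs_expect_le_sub_normalCDF_le (h0 : 0 ≤ p) (h1 : p ≤ 1) {U : Finset ι → ℝ}
    {a β : ℝ} {b : ι → ι → ℝ} (hE : expect p U = 0) (hV : expect p (fun x => U x ^ 2) = 1)
    (ha0 : 0 ≤ a) (hβ0 : 0 ≤ β) (ha : ∀ i x, |diff i U x| ≤ a)
    (hb : ∀ i j, i ≠ j → ∀ x, |diff j (diff i U) x| ≤ b i j)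
    (hβ : ∀ j, ∑ i ∈ Finset.univ.erase j, b i j ≤ β) (z : ℝ) :
    |expect p (fun x => if U x ≤ z then 1 else 0) - normalCDF z| ≤
      3 * √(Fintype.card ι) * (a ^ 2 + 2 * a * β) := by
  obtain ⟨K, hrep, hanti, hK, hDK⟩ := exists_clarkOcone h0 h1 U
  have hKa : ∀ i x, |K i x| ≤ a := fun i => hK i a (ha i)
  have hDKb : ∀ i j, i ≠ j → ∀ x, |diff j (K i) x| ≤ b i j := fun i j hij =>
    hDK i j _ (hb i j hij)
  simp only [hE, sub_zero] at hrep
  set T : Finset ι → ℝ := gammaSum p K U with hT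
  -- The kernels are odd under their own flip, so their absolute values are even, as
  -- `sum_expect_mul_diff_mul` requires; the reverse triangle inequality preserves the difference
  -- bounds.
  set M : ι → Finset ι → ℝ := fun i x => |K i x| with hM
  set T' : Finset ι → ℝ := gammaSum p M U with hT'
  have hMa : ∀ i x, |M i x| ≤ a := fun i x => by simpa [hM] using hKa i x
  have hDMb : ∀ i j, i ≠ j → ∀ x, |diff j (M i) x| ≤ b i j := fun i j hij x =>
    (abs_abs_sub_abs_le_abs_sub _ _).trans (hDKb i j hij x)
  have hMsymm : ∀ i x, M i (flip i x) = M i x := fun i x => by simp only [hM, hanti, abs_neg]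
  set δ : ℝ := a ^ 2 + 2 * a * β with hδ
  have hδ0 : 0 ≤ δ := by positivity
  have hTsum : ∀ g : Finset ι → ℝ, ∑ i, expect p (fun x =>
      flipProb p i x * (K i x * (diff i U x * g x))) = expect p fun x => T x * g x := by
    intro g
    simp only [hT, gammaSum, Finset.sum_mul, expect_sum]
    refine Finset.sum_congr rfl fun i _ => ?_
    congr 1
    funext x
    ring
  -- Testing the Clark–Ocone formula on `U` itself gives `Var U = E[T] / 2`.
  have hET : expect p T = 2 := by
    have h := hrep U
    simp only [← sq] at h
    rw [hV] at h
    have h2 := hTsum fun _ => 1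
    simp only [mul_one] at h2
    rw [h2] at h
    linarith
  have hET' : expect p T' = 0 := by
    have h := sum_expect_mul_diff_mul (p := p) M hMsymm U fun _ => 1
    simp only [mul_one] at h
    have e : ∀ i x, diff i (fun _ : Finset ι => (1 : ℝ)) x = 0 := fun i x => sub_self _
    simp only [e, mul_zero, expect_const, Finset.sum_const_zero] at h
    change expect p (fun x => gammaSum p M U x) = 0
    linarith
  have hTdev := expect_abs_sub_le h0 h1 hδ0 (abs_diff_gammaSum_le h0 h1 ha hb hβ hKa hDKb)
  have hTdev' := expect_abs_sub_le h0 h1 hδ0 (abs_diff_gammaSum_le h0 h1 ha hb hβ hMa hDMb)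
  rw [← hT, hET] at hTdev
  rw [← hT', hET'] at hTdev'
  simp only [sub_zero] at hTdev'
  set f : ℝ → ℝ := steinSolution z with hf
  set f' : ℝ → ℝ := steinDeriv z with hf'
  set g : Finset ι → ℝ := fun x => U x * f (U x) with hg
  set h : Finset ι → ℝ := fun x => if U x ≤ z then 1 else 0 with hh
  have hstein : expect p h - normalCDF z =
      expect p (fun x => f' (U x)) - expect p (fun x => U x * f (U x)) := by
    rw [← expect_const (p := p) (ι := ι) (normalCDF z), ← expect_sub, ← expect_sub]
    congr 1
    funext x
    simp only [hf', steinDeriv, hh]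
    ring
  have hsplit : expect p h - normalCDF z =
      1 / 2 * expect p (fun x => (2 - T x) * f' (U x)) -
        1 / 2 * ∑ i, expect p (fun x => flipProb p i x *
          (K i x * (diff i (fun x => f (U x)) x - diff i U x * f' (U x)))) := by
    rw [hstein, hrep fun x => f (U x)]
    have e1 : expect p (fun x => (2 - T x) * f' (U x)) =
        2 * expect p (fun x => f' (U x)) - expect p fun x => T x * f' (U x) := by
      rw [← expect_const_mul, ← expect_sub]
      congr 1
      funext x
      ring
    have e2 : ∑ i, expect p (fun x => flipProb p i x *
          (K i x * (diff i (fun x => f (U x)) x - diff i U x * f' (U x)))) =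
        ∑ i, expect p (fun x => flipProb p i x * (K i x * diff i (fun x => f (U x)) x)) -
          expect p fun x => T x * f' (U x) := by
      rw [← hTsum fun x => f' (U x), ← Finset.sum_sub_distrib]
      refine Finset.sum_congr rfl fun i _ => ?_
      rw [← expect_sub]
      congr 1
      funext x
      ring
    rw [e1, e2]
    ring
  have hfirst : |expect p (fun x => (2 - T x) * f' (U x))| ≤ √(Fintype.card ι) * δ := by
    refine (abs_expect_le h0 h1 _).trans (le_trans (expect_mono h0 h1 fun x => ?_) hTdev)
    rw [abs_mul, abs_sub_comm]
    exact mul_le_of_le_one_right (abs_nonneg _) (abs_steinDeriv_le z _)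
  have hT'g : ∀ V : Finset ι → ℝ, (∀ x, |V x| ≤ 1) →
      |expect p fun x => T' x * V x| ≤ √(Fintype.card ι) * δ := by
    intro V hV1
    refine (abs_expect_le h0 h1 _).trans (le_trans (expect_mono h0 h1 fun x => ?_) hTdev')
    rw [abs_mul]
    exact mul_le_of_le_one_right (abs_nonneg _) (hV1 x)
  have hrem : |∑ i, expect p (fun x => flipProb p i x *
      (K i x * (diff i (fun x => f (U x)) x - diff i U x * f' (U x))))| ≤
      4 * (√(Fintype.card ι) * δ) := by
    have hterm : ∀ i, |expect p (fun x => flipProb p i x *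
        (K i x * (diff i (fun x => f (U x)) x - diff i U x * f' (U x))))| ≤
        expect p (fun x => flipProb p i x * (M i x * (diff i U x * diff i g x))) -
          expect p (fun x => flipProb p i x * (M i x * (diff i U x * diff i h x))) := by
      intro i
      rw [← expect_sub]
      refine (abs_expect_le h0 h1 _).trans (expect_mono h0 h1 fun x => ?_)
      rw [abs_mul, abs_mul, abs_of_nonneg (flipProb_nonneg h0 h1 i x), ← mul_sub, ← mul_sub]
      refine mul_le_mul_of_nonneg_left ?_ (flipProb_nonneg h0 h1 i x)
      refine mul_le_mul_of_nonneg_left ?_ (abs_nonneg _)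
      -- Here `g` and `h` are bounded by one, so once summed over `i` each increment costs at most
      -- `2 E|T'|`.
      refine (abs_steinSolution_sub_le z (U x) (U (flip i x))).trans (le_of_eq ?_)
      simp only [diff, hg, hh, hf]
      ring
    refine (Finset.abs_sum_le_sum_abs _ _).trans
      ((Finset.sum_le_sum fun i _ => hterm i).trans ?_)
    rw [Finset.sum_sub_distrib, sum_expect_mul_diff_mul M hMsymm,
      sum_expect_mul_diff_mul M hMsymm]
    have hg1 := hT'g g fun x => abs_mul_steinSolution_le z (U x)
    have hh1 := hT'g h fun x => by
      simp only [hh]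
      split_ifs <;> simp
    rw [abs_le] at hg1 hh1
    linarith [hg1.2, hh1.1]
  -- The two errors add up to `1/2 + 4/2 = 5/2` times `√N δ`, rounded up to 3.
  rw [hsplit]
  rw [abs_le] at hfirst hrem ⊢
  have : 0 ≤ √(Fintype.card ι) * δ := by positivity
  constructor <;> linarith [hfirst.1, hfirst.2, hrem.1, hrem.2]

/-! ### Counting members of a uniform regular set family. -/

/-- The centred indicator of `i`. -/
noncomputable def centered (p : ℝ) (i : ι) (x : Finset ι) : ℝ := (if i ∈ x then 1 else 0) - p

omit [Fintype ι] in
lemma centered_flip_of_ne {i j : ι} (h : j ≠ i) (x : Finset ι) :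
    centered p j (flip i x) = centered p j x := by
  simp only [centered, mem_flip_of_ne h]

omit [Fintype ι] in
lemma sq_centered_le_one (h0 : 0 ≤ p) (h1 : p ≤ 1) (i : ι) (x : Finset ι) :
    centered p i x * centered p i x ≤ 1 := by
  rw [centered]
  split_ifs <;> nlinarith

/-- The centred indicator is `flipProb` times a sign that is odd under the flip, so reversibility
makes the expectation its own negative. -/
lemma expect_centered_mul {i : ι} {V : Finset ι → ℝ} (hV : ∀ x, V (flip i x) = V x) :
    expect p (fun x => centered p i x * V x) = 0 := by
  have e : ∀ x, centered p i x * V x =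
      flipProb p i x * ((if i ∈ x then 1 else -1) * V x) := fun x => by
    rw [centered, flipProb]
    split_ifs <;> ring
  have h := expect_flipProb_mul_flip (p := p) i fun x => (if i ∈ x then 1 else -1) * V x
  have e' : ∀ x, flipProb p i x * ((if i ∈ flip i x then 1 else -1) * V (flip i x)) =
      (-1) * (flipProb p i x * ((if i ∈ x then 1 else -1) * V x)) := fun x => by
    simp only [hV, mem_flip_self]
    split_ifs <;> ring
  simp only [e', expect_const_mul] at h
  simp only [e]
  linarith

/-- The indicator that the random set contains `s`. -/
noncomputable def containsInd (s x : Finset ι) : ℝ := if s ⊆ x then 1 else 0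

omit [Fintype ι] in
lemma containsInd_flip {s : Finset ι} {i : ι} (h : i ∉ s) (x : Finset ι) :
    containsInd s (flip i x) = containsInd s x := by
  have : s ⊆ flip i x ↔ s ⊆ x := by
    refine forall₂_congr fun j hj => ?_
    exact mem_flip_of_ne (ne_of_mem_of_not_mem hj h)
  simp only [containsInd, this]

omit [Fintype ι] in
lemma abs_diff_containsInd_le (s : Finset ι) (i : ι) (x : Finset ι) :
    |diff i (containsInd s) x| ≤ if i ∈ s then 1 else 0 := by
  split_ifs with h
  · simp only [diff, containsInd]
    split_ifs <;> norm_num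
  · rw [diff_eq_zero (containsInd_flip h), abs_zero]

omit [Fintype ι] in
lemma abs_diff_diff_containsInd_le (s : Finset ι) (i j : ι) (x : Finset ι) :
    |diff j (diff i (containsInd s)) x| ≤ if i ∈ s ∧ j ∈ s then 2 else 0 := by
  have hi : i ∉ s → diff j (diff i (containsInd s)) x = 0 := fun h =>
    diff_eq_zero (fun x => by
      rw [diff_eq_zero (containsInd_flip h), diff_eq_zero (containsInd_flip h)]) x
  have hj : j ∉ s → diff j (diff i (containsInd s)) x = 0 := fun h => by
    rw [diff_comm]
    exact diff_eq_zero (fun x => by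
      rw [diff_eq_zero (containsInd_flip h), diff_eq_zero (containsInd_flip h)]) x
  split_ifs with h
  · have h1 := abs_diff_containsInd_le s i x
    have h2 := abs_diff_containsInd_le s i (flip j x)
    rw [if_pos h.1] at h1 h2
    refine (abs_sub _ _).trans ?_
    linarith
  · rcases not_and_or.1 h with h | h
    · rw [hi h, abs_zero]
    · rw [hj h, abs_zero]

lemma expect_containsInd (s : Finset ι) : expect p (containsInd s) = p ^ s.card := by
  induction s using Finset.induction_on with
  | empty =>
    have e : containsInd (∅ : Finset ι) = fun _ => 1 := funext fun x => by simp [containsInd]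
    rw [e, expect_const, Finset.card_empty, pow_zero]
  | insert i s hi ih =>
    have h := expect_centered_mul (p := p) (containsInd_flip hi)
    have e : ∀ x, centered p i x * containsInd s x =
        containsInd (insert i s) x - p * containsInd s x := fun x => by
      simp only [centered, containsInd, Finset.insert_subset_iff]
      split_ifs <;> simp_all
    simp only [e] at h
    rw [expect_sub, expect_const_mul] at h
    rw [Finset.card_insert_of_notMem hi, pow_succ', ← ih]
    exact sub_eq_zero.1 h

lemma expect_centered_mul_containsInd (s : Finset ι) (i : ι) :
    expect p (fun x => centered p i x * containsInd s x) =
      if i ∈ s then (1 - p) * p ^ s.card else 0 := by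
  split_ifs with h
  · rw [← expect_containsInd, ← expect_const_mul]
    congr 1
    funext x
    simp only [centered, containsInd]
    split_ifs with h1 h2 h2 <;> simp_all
    exact absurd (h2 h) h1
  · exact expect_centered_mul (containsInd_flip h)

variable {α : Type*}

/-- The number of members of a family of sets that are contained in the random set. -/
noncomputable def containedCount (𝓗 : Finset α) (E : α → Finset ι) (x : Finset ι) : ℝ :=
  ∑ H ∈ 𝓗, containsInd (E H) x

omit [Fintype ι] in
lemma diff_containedCount (𝓗 : Finset α) (E : α → Finset ι) (i : ι) :
    diff i (containedCount 𝓗 E) = fun x => ∑ H ∈ 𝓗, diff i (containsInd (E H)) x := by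
  funext x
  simp only [diff, containedCount, Finset.sum_sub_distrib]

omit [Fintype ι] in
lemma abs_diff_containedCount_le {𝓗 : Finset α} {E : α → Finset ι} {d : ℕ}
    (hd : ∀ i, (𝓗.filter fun H => i ∈ E H).card = d) (i : ι) (x : Finset ι) :
    |diff i (containedCount 𝓗 E) x| ≤ d := by
  rw [diff_containedCount, ← hd i, Finset.card_filter]
  push_cast
  exact (Finset.abs_sum_le_sum_abs _ _).trans
    (Finset.sum_le_sum fun H _ => abs_diff_containsInd_le _ _ _)

omit [Fintype ι] in
lemma abs_diff_diff_containedCount_le (𝓗 : Finset α) (E : α → Finset ι) (i j : ι)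
    (x : Finset ι) :
    |diff j (diff i (containedCount 𝓗 E)) x| ≤ ∑ H ∈ 𝓗, if i ∈ E H ∧ j ∈ E H then 2 else 0 := by
  have e : diff j (diff i (containedCount 𝓗 E)) x =
      ∑ H ∈ 𝓗, diff j (diff i (containsInd (E H))) x := by
    rw [diff_containedCount]
    simp only [diff, Finset.sum_sub_distrib]
  rw [e]
  exact (Finset.abs_sum_le_sum_abs _ _).trans
    (Finset.sum_le_sum fun H _ => abs_diff_diff_containsInd_le _ _ _ _)

/-- Exactly `d` members contain `j`, each has `k` elements, and each incidence counts 2. This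
supplies the second-difference bound `β`. -/
lemma sum_codegree_eq {𝓗 : Finset α} {E : α → Finset ι} {k d : ℕ}
    (hk : ∀ H ∈ 𝓗, (E H).card = k) (hd : ∀ i, (𝓗.filter fun H => i ∈ E H).card = d) (j : ι) :
    ∑ i, ∑ H ∈ 𝓗, (if i ∈ E H ∧ j ∈ E H then (2 : ℝ) else 0) = 2 * k * d := by
  rw [Finset.sum_comm]
  have e : ∀ H ∈ 𝓗, ∑ i, (if i ∈ E H ∧ j ∈ E H then (2 : ℝ) else 0) =
      if j ∈ E H then 2 * (k : ℝ) else 0 := by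
    intro H hH
    split_ifs with h
    · simp only [h, and_true, Finset.sum_ite_mem, Finset.univ_inter, Finset.sum_const, hk H hH,
        nsmul_eq_mul]
      ring
    · simp [h]
  rw [Finset.sum_congr rfl e, ← Finset.sum_filter, Finset.sum_const, hd, nsmul_eq_mul]
  ring

lemma card_mul_eq_of_regular {𝓗 : Finset α} {E : α → Finset ι} {k d : ℕ}
    (hk : ∀ H ∈ 𝓗, (E H).card = k) (hd : ∀ i, (𝓗.filter fun H => i ∈ E H).card = d) :
    𝓗.card * k = Fintype.card ι * d := by
  have h1 : ∑ H ∈ 𝓗, (E H).card = 𝓗.card * k := by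
    rw [Finset.sum_congr rfl hk, Finset.sum_const, smul_eq_mul]
  have h2 : ∑ i : ι, (𝓗.filter fun H => i ∈ E H).card = Fintype.card ι * d := by
    simp only [hd, Finset.sum_const, smul_eq_mul, Finset.card_univ]
  rw [← h1, ← h2]
  simp only [Finset.card_filter]
  rw [Finset.sum_comm]
  simp

lemma expect_sq_sum_centered_le (h0 : 0 ≤ p) (h1 : p ≤ 1) :
    expect p (fun x : Finset ι => (∑ i, centered p i x) ^ 2) ≤ Fintype.card ι := by
  simp only [sq, Finset.sum_mul_sum, expect_sum]
  calc _ ≤ ∑ i : ι, ∑ j : ι, (if i = j then (1 : ℝ) else 0) := by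
        refine Finset.sum_le_sum fun i _ => Finset.sum_le_sum fun j _ => ?_
        split_ifs with h
        · rw [← h, ← expect_const (p := p) (ι := ι) 1]
          exact expect_mono h0 h1 (sq_centered_le_one h0 h1 i)
        · exact (expect_centered_mul (centered_flip_of_ne (Ne.symm h))).le
    _ = Fintype.card ι := by simp

/-- Lower bound for the variance through the covariance with the number of elements. -/
lemma le_variance_containedCount (h0 : 0 ≤ p) (h1 : p ≤ 1) {𝓗 : Finset α} {E : α → Finset ι}
    {k d : ℕ} (hk : ∀ H ∈ 𝓗, (E H).card = k) (hd : ∀ i, (𝓗.filter fun H => i ∈ E H).card = d)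
    (hι : 0 < Fintype.card ι) :
    ((1 - p) * p ^ k) ^ 2 * Fintype.card ι * d ^ 2 ≤
      expect p (fun x => (containedCount 𝓗 E x - expect p (containedCount 𝓗 E)) ^ 2) := by
  set μ := expect p (containedCount 𝓗 E) with hμ
  -- Each member has covariance `k (1 - p) p ^ k` with the centred cardinality, and `𝓗.card * k = N
  -- * d` by double counting, `N` being the size of the ground set.
  have hcov : expect p (fun x => (containedCount 𝓗 E x - μ) * ∑ i, centered p i x) =
      (1 - p) * p ^ k * (Fintype.card ι * d) := by
    have e : (fun x => (containedCount 𝓗 E x - μ) * ∑ i, centered p i x) = fun x =>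
        (∑ H ∈ 𝓗, ∑ i, centered p i x * containsInd (E H) x) -
          ∑ i, centered p i x * μ := by
      funext x
      rw [← Finset.sum_mul, containedCount, sub_mul, Finset.sum_mul_sum, mul_comm μ]
      simp only [mul_comm]
    rw [e, expect_sub]
    simp only [expect_sum]
    have e1 : ∀ i : ι, expect p (fun x => centered p i x * μ) = 0 := fun i =>
      expect_centered_mul fun _ => rfl
    simp only [e1, Finset.sum_const_zero, sub_zero, expect_centered_mul_containsInd]
    rw [← Nat.cast_mul, ← card_mul_eq_of_regular hk hd]
    have e2 : ∀ H ∈ 𝓗, ∑ i, (if i ∈ E H then (1 - p) * p ^ (E H).card else 0) =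
        k * ((1 - p) * p ^ k) := by
      intro H hH
      simp only [Finset.sum_ite_mem, Finset.univ_inter, Finset.sum_const, hk H hH, nsmul_eq_mul]
    rw [Finset.sum_congr rfl e2, Finset.sum_const, nsmul_eq_mul]
    push_cast
    ring
  -- Cauchy–Schwarz bounds the squared covariance by the variance times `N`; one factor `N` then
  -- cancels.
  have hcs := sq_expect_mul_le h0 h1 (fun x => containedCount 𝓗 E x - μ)
    (fun x => ∑ i, centered p i x)
  rw [hcov] at hcs
  have hN : (0 : ℝ) < Fintype.card ι := by exact_mod_cast hι
  have hvar : 0 ≤ expect p (fun x => (containedCount 𝓗 E x - μ) ^ 2) :=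
    expect_nonneg h0 h1 fun x => sq_nonneg _
  have h2 := hcs.trans (mul_le_mul_of_nonneg_left (expect_sq_sum_centered_le h0 h1) hvar)
  refine le_of_mul_le_mul_right (le_trans (le_of_eq ?_) h2) hN
  ring

/-- **Berry–Esseen bound for the number of members of a uniform and regular family of sets that are
contained in a binomial random subset.** -/
theorem abs_expect_containedCount_sub_normalCDF_le (h0 : 0 < p) (h1 : p < 1) {𝓗 : Finset α}
    {E : α → Finset ι} {k d : ℕ} (hk : ∀ H ∈ 𝓗, (E H).card = k)
    (hd : ∀ i, (𝓗.filter fun H => i ∈ E H).card = d) (hd0 : 0 < d) (hι : 0 < Fintype.card ι)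
    (z : ℝ) :
    |expect p (fun x => if (containedCount 𝓗 E x - expect p (containedCount 𝓗 E)) /
        √(expect p (fun x => (containedCount 𝓗 E x - expect p (containedCount 𝓗 E)) ^ 2)) ≤ z
        then 1 else 0) - normalCDF z| ≤
      3 * (1 + 4 * k) / (((1 - p) * p ^ k) ^ 2 * √(Fintype.card ι)) := by
  have hvar := le_variance_containedCount h0.le h1.le hk hd hι
  set S := containedCount 𝓗 E with hS
  set μ := expect p S with hμ
  set v := expect p (fun x => (S x - μ) ^ 2) with hv
  set c := (1 - p) * p ^ k with hc
  have hc0 : 0 < c := mul_pos (sub_pos.2 h1) (pow_pos h0 k)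
  have hN : (0 : ℝ) < Fintype.card ι := by exact_mod_cast hι
  have hdR : (0 : ℝ) < d := by exact_mod_cast hd0
  have hv0 : 0 < v := lt_of_lt_of_le (by positivity) hvar
  set σ := √v with hσ
  have hσ0 : 0 < σ := Real.sqrt_pos.2 hv0
  have hσ2 : σ ^ 2 = v := Real.sq_sqrt hv0.le
  have hdiff : ∀ i, diff i (fun x => (S x - μ) / σ) = fun x => diff i S x / σ := fun i => by
    funext x
    simp only [diff]
    ring
  have hdiff2 : ∀ i j x, diff j (diff i fun x => (S x - μ) / σ) x = diff j (diff i S) x / σ :=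
    fun i j x => by
      rw [hdiff]
      simp only [diff]
      ring
  have main := abs_expect_le_sub_normalCDF_le h0.le h1.le (U := fun x => (S x - μ) / σ)
    (a := d / σ) (β := 2 * k * d / σ)
    (b := fun i j => (∑ H ∈ 𝓗, if i ∈ E H ∧ j ∈ E H then 2 else 0) / σ) ?_ ?_
    (by positivity) (by positivity) ?_ ?_ ?_ z
  · refine main.trans ?_
    have hr : √(Fintype.card ι : ℝ) ^ 2 = Fintype.card ι := Real.sq_sqrt hN.le
    have hr0 : 0 < √(Fintype.card ι : ℝ) := Real.sqrt_pos.2 hN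
    set r := √(Fintype.card ι : ℝ) with hrdef
    have e : 3 * r * ((d / σ) ^ 2 + 2 * (d / σ) * (2 * k * d / σ)) =
        3 * (1 + 4 * k) * (r * d ^ 2 / v) := by
      rw [← hσ2]
      field_simp
      ring
    -- The variance bound `c ^ 2 * r ^ 2 * d ^ 2 ≤ v` removes all dependence on `d`.
    have h3 : r * d ^ 2 / v ≤ 1 / (c ^ 2 * r) := by
      rw [div_le_div_iff₀ hv0 (by positivity)]
      rw [← hr] at hvar
      linarith
    rw [e, div_eq_mul_one_div (3 * (1 + 4 * (k : ℝ)))]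
    exact mul_le_mul_of_nonneg_left h3 (by positivity)
  · have e : (fun x => (S x - μ) / σ) = fun x => σ⁻¹ * (S x - μ) := by
      funext x; ring
    rw [e, expect_const_mul, expect_sub, expect_const, ← hμ, sub_self, mul_zero]
  · have e : (fun x => ((S x - μ) / σ) ^ 2) = fun x => v⁻¹ * (S x - μ) ^ 2 := by
      funext x
      rw [div_pow, hσ2]; ring
    rw [e, expect_const_mul]
    exact inv_mul_cancel₀ hv0.ne'
  · intro i x
    rw [hdiff, abs_div, abs_of_pos hσ0]
    exact div_le_div_of_nonneg_right (abs_diff_containedCount_le hd i x) hσ0.le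
  · intro i j _ x
    rw [hdiff2, abs_div, abs_of_pos hσ0]
    exact div_le_div_of_nonneg_right (abs_diff_diff_containedCount_le 𝓗 E i j x) hσ0.le
  · intro j
    rw [← Finset.sum_div]
    refine div_le_div_of_nonneg_right ?_ hσ0.le
    rw [← sum_codegree_eq hk hd j]
    refine Finset.sum_le_univ_sum_of_nonneg fun i => Finset.sum_nonneg fun H _ => ?_
    split_ifs <;> norm_num

end BernoulliCube

/-! ### Subgraph counts as functions on the cube of possible edges. -/

namespace SimpleGraph

variable {V W : Type*}

/-- The possible edges of a graph on `V`. -/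
abbrev PossibleEdge (V : Type*) : Type _ := {e : Sym2 V // ¬e.IsDiag}

/-- The copies of `Γ` in the complete graph on `V`. -/
noncomputable def completeCopies (V : Type*) [Finite V] (Γ : SimpleGraph W) :
    Finset (⊤ : SimpleGraph V).Subgraph :=
  (Set.toFinite {H : (⊤ : SimpleGraph V).Subgraph | Nonempty (Γ ≃g H.coe)}).toFinset

lemma mem_completeCopies [Finite V] {Γ : SimpleGraph W} {H : (⊤ : SimpleGraph V).Subgraph} :
    H ∈ completeCopies V Γ ↔ ∃ f : Copy Γ (⊤ : SimpleGraph V), f.toSubgraph = H := by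
  have h := congrArg (H ∈ ·) (Copy.range_toSubgraph (A := Γ) (B := (⊤ : SimpleGraph V)))
  simp only [Set.mem_range, eq_iff_iff] at h
  rw [h, completeCopies, Set.Finite.mem_toFinset]

open Classical in
/-- The edges of a subgraph of the complete graph. -/
noncomputable def possibleEdges [Fintype V] (H : (⊤ : SimpleGraph V).Subgraph) :
    Finset (PossibleEdge V) :=
  Finset.univ.filter fun e => e.1 ∈ H.edgeSet

lemma mem_possibleEdges [Fintype V] {H : (⊤ : SimpleGraph V).Subgraph} {e : PossibleEdge V} :
    e ∈ possibleEdges H ↔ e.1 ∈ H.edgeSet := by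
  simp [possibleEdges]

/-- The graph with a given set of edges. -/
def ofPossibleEdges (x : Finset (PossibleEdge V)) : SimpleGraph V :=
  fromEdgeSet (Subtype.val '' (x : Set (PossibleEdge V)))

lemma edgeSet_ofPossibleEdges (x : Finset (PossibleEdge V)) :
    (ofPossibleEdges x).edgeSet = Subtype.val '' (x : Set (PossibleEdge V)) := by
  rw [ofPossibleEdges, edgeSet_fromEdgeSet, sdiff_eq_left, Set.disjoint_left]
  rintro _ ⟨e, -, rfl⟩ he
  exact e.2 he

lemma mem_edgeSet_ofPossibleEdges {x : Finset (PossibleEdge V)} {e : PossibleEdge V} :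
    e.1 ∈ (ofPossibleEdges x).edgeSet ↔ e ∈ x := by
  rw [edgeSet_ofPossibleEdges, Subtype.val_injective.mem_set_image, Finset.mem_coe]

lemma bijective_ofPossibleEdges [Finite V] :
    Function.Bijective (ofPossibleEdges : Finset (PossibleEdge V) → SimpleGraph V) := by
  classical
  have := Fintype.ofFinite V
  constructor
  · intro x y h
    ext e
    rw [← mem_edgeSet_ofPossibleEdges, h, mem_edgeSet_ofPossibleEdges]
  · intro G
    refine ⟨Finset.univ.filter fun e => e.1 ∈ G.edgeSet, ?_⟩
    rw [← edgeSet_inj, edgeSet_ofPossibleEdges]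
    ext e
    simp only [Finset.coe_filter, Finset.mem_univ, true_and, Set.mem_image, Set.mem_ofPred_eq]
    constructor
    · rintro ⟨e, he, rfl⟩
      exact he
    · exact fun he => ⟨⟨e, G.not_isDiag_of_mem_edgeSet he⟩, he, rfl⟩

lemma ncard_edgeSet_ofPossibleEdges (x : Finset (PossibleEdge V)) :
    (ofPossibleEdges x).edgeSet.ncard = x.card := by
  rw [edgeSet_ofPossibleEdges, Set.ncard_image_of_injective _ Subtype.val_injective,
    Set.ncard_coe_finset]

/-- A subgraph of `G` as a subgraph of the complete graph. -/
def Subgraph.toTop {G : SimpleGraph V} (G' : G.Subgraph) : (⊤ : SimpleGraph V).Subgraph where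
  verts := G'.verts
  Adj := G'.Adj
  adj_sub h := (G'.adj_sub h).ne
  edge_vert := G'.edge_vert
  symm := G'.symm

lemma Subgraph.toTop_injective {G : SimpleGraph V} :
    Function.Injective (Subgraph.toTop : G.Subgraph → (⊤ : SimpleGraph V).Subgraph) := by
  intro G₁ G₂ h
  have h' := Subgraph.ext_iff.1 h
  exact Subgraph.ext h'.1 h'.2

lemma Subgraph.exists_toTop_eq {G : SimpleGraph V} {H : (⊤ : SimpleGraph V).Subgraph}
    (h : ∀ v w, H.Adj v w → G.Adj v w) : ∃ G' : G.Subgraph, G'.toTop = H :=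
  ⟨{ verts := H.verts
     Adj := H.Adj
     adj_sub := h _ _
     edge_vert := H.edge_vert
     symm := H.symm }, rfl⟩

lemma Subgraph.nonempty_iso_toTop {G : SimpleGraph V} {Γ : SimpleGraph W} (G' : G.Subgraph) :
    Nonempty (Γ ≃g G'.toTop.coe) ↔ Nonempty (Γ ≃g G'.coe) :=
  ⟨fun ⟨φ⟩ => ⟨⟨φ.toEquiv, φ.map_rel_iff⟩⟩, fun ⟨φ⟩ => ⟨⟨φ.toEquiv, φ.map_rel_iff⟩⟩⟩

/-- A copy is contained in the graph exactly when its edges are present. Copies carry their vertex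
sets, so isolated vertices of `Γ` may give several copies with equal edges; hence the family is
indexed by copies, not by edge sets. -/
lemma copyCount_ofPossibleEdges [Fintype V] [DecidableEq V] (Γ : SimpleGraph W)
    (x : Finset (PossibleEdge V)) :
    ((ofPossibleEdges x).copyCount Γ : ℝ) =
      BernoulliCube.containedCount (completeCopies V Γ) possibleEdges x := by
  classical
  have hle : ∀ H : (⊤ : SimpleGraph V).Subgraph, possibleEdges H ⊆ x ↔
      ∀ v w, H.Adj v w → (ofPossibleEdges x).Adj v w := by
    intro H
    constructor
    · intro h v w hvw
      have he : ¬(s(v, w)).IsDiag := by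
        simpa using hvw.ne
      have := h (mem_possibleEdges.2 (show (⟨s(v, w), he⟩ : PossibleEdge V).1 ∈ H.edgeSet from hvw))
      exact mem_edgeSet_ofPossibleEdges.2 this
    · rintro h ⟨e, he⟩ heH
      rw [mem_possibleEdges] at heH
      rw [← mem_edgeSet_ofPossibleEdges]
      induction e with
      | h v w => exact h v w heH
  simp only [BernoulliCube.containedCount, BernoulliCube.containsInd]
  rw [← Finset.sum_filter, Finset.sum_const, nsmul_eq_mul, mul_one, copyCount]
  congr 1
  refine Finset.card_bij (fun G' _ => G'.toTop) ?_ (fun _ _ _ _ h => Subgraph.toTop_injective h) ?_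
  · intro G' hG'
    rw [Finset.mem_filter, completeCopies, Set.Finite.mem_toFinset, hle]
    exact ⟨G'.nonempty_iso_toTop.2 (Finset.mem_filter.1 hG').2, fun v w h => G'.adj_sub h⟩
  · intro H hH
    rw [Finset.mem_filter, completeCopies, Set.Finite.mem_toFinset, hle] at hH
    obtain ⟨G', rfl⟩ := Subgraph.exists_toTop_eq hH.2
    refine ⟨G', ?_, rfl⟩
    rw [Finset.mem_filter]
    refine ⟨?_, G'.nonempty_iso_toTop.1 hH.1⟩
    simp

lemma card_possibleEdges [Fintype V] {Γ : SimpleGraph W} {H : (⊤ : SimpleGraph V).Subgraph}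
    (hH : H ∈ completeCopies V Γ) : (possibleEdges H).card = Γ.edgeSet.ncard := by
  obtain ⟨f, rfl⟩ := mem_completeCopies.1 hH
  rw [← Set.ncard_coe_finset, ← Set.ncard_image_of_injective _ Subtype.val_injective,
    ← Set.ncard_image_of_injective _ (Sym2.map.injective f.injective)]
  congr 1
  ext e
  simp only [Set.mem_image, Finset.mem_coe, mem_possibleEdges, Subgraph.edgeSet_map]
  constructor
  · rintro ⟨e, he, rfl⟩
    simpa using he
  · intro he
    have he' : e ∈ Sym2.map f.toHom '' (⊤ : Γ.Subgraph).edgeSet := by simpa using he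
    refine ⟨⟨e, ?_⟩, he', rfl⟩
    have : e ∈ (Copy.toSubgraph f).edgeSet := by rwa [Subgraph.edgeSet_map]
    exact (⊤ : SimpleGraph V).not_isDiag_of_mem_edgeSet (Subgraph.edgeSet_subset _ this)

/-- The endomorphism of the complete graph given by a permutation of the vertices. -/
def permHom (π : Equiv.Perm V) : (⊤ : SimpleGraph V) →g (⊤ : SimpleGraph V) where
  toFun := π
  map_rel' h := π.injective.ne h

lemma exists_perm_map_eq [DecidableEq V] (e f : PossibleEdge V) :
    ∃ π : Equiv.Perm V, Sym2.map π e.1 = f.1 := by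
  obtain ⟨e, he⟩ := e
  obtain ⟨f, hf⟩ := f
  induction e with | h a b => ?_
  induction f with | h c d => ?_
  rw [Sym2.mk_isDiag_iff] at he hf
  have hb : Equiv.swap a c b ≠ c := fun h => he <| by
    have h2 := congrArg (Equiv.swap a c) h
    rw [Equiv.swap_apply_self, Equiv.swap_apply_right] at h2
    exact h2.symm
  -- The first swap sends `a` to `c`; the second moves the image of `b` to `d` and fixes `c`, which
  -- differs from both.
  refine ⟨Equiv.swap (Equiv.swap a c b) d * Equiv.swap a c, ?_⟩
  simp only [Sym2.map_mk, Equiv.Perm.mul_apply, Equiv.swap_apply_left]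
  rw [Equiv.swap_apply_of_ne_of_ne hb.symm hf]

/-- A vertex permutation carrying `e` to `f` maps copies through `e` injectively to copies through
`f`. Used in both directions, this makes the family regular. -/
lemma card_filter_mem_possibleEdges_le [Fintype V] [DecidableEq V] (Γ : SimpleGraph W)
    (e f : PossibleEdge V) :
    ((completeCopies V Γ).filter fun H => e ∈ possibleEdges H).card ≤
      ((completeCopies V Γ).filter fun H => f ∈ possibleEdges H).card := by
  obtain ⟨π, hπ⟩ := exists_perm_map_eq e f
  refine Finset.card_le_card_of_injOn (Subgraph.map (permHom π)) ?_ ?_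
  · intro H hH
    rw [Finset.mem_coe, Finset.mem_filter] at hH ⊢
    refine ⟨?_, ?_⟩
    · obtain ⟨g, rfl⟩ := mem_completeCopies.1 hH.1
      refine mem_completeCopies.2
        ⟨⟨(permHom π).comp g.toHom, π.injective.comp g.injective⟩, ?_⟩
      rw [← Subgraph.map_comp]
    · rw [mem_possibleEdges, Subgraph.edgeSet_map]
      exact ⟨e.1, mem_possibleEdges.1 hH.2, hπ⟩
  · have hinv : ∀ H : (⊤ : SimpleGraph V).Subgraph,
        Subgraph.map (permHom π⁻¹) (Subgraph.map (permHom π) H) = H := by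
      intro H
      rw [← Subgraph.map_comp]
      have : (permHom π⁻¹).comp (permHom π) = Hom.id := by
        ext v
        exact π.symm_apply_apply v
      rw [this, Subgraph.map_id]
    exact (Function.LeftInverse.injective hinv).injOn

/-- On a finite vertex set this makes every function of the graph measurable, so integrals are
finite sums. -/
lemma measurableSingletonClass [Countable V] : MeasurableSingletonClass (SimpleGraph V) where
  measurableSet_singleton G := by
    have h : ({G} : Set (SimpleGraph V)) = edgeSet ⁻¹' {G.edgeSet} := by
      ext H
      simp
    rw [h]
    exact measurable_edgeSet (measurableSet_singleton _)

/-- Expectations under the law of the binomial random graph are expectations over random sets of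
edges. -/
lemma integral_binomialRandom [Fintype V] [DecidableEq V] (p : unitInterval)
    (U : SimpleGraph V → ℝ) :
    ∫ G, U G ∂(binomialRandom V p) =
      BernoulliCube.expect (p : ℝ) fun x : Finset (PossibleEdge V) => U (ofPossibleEdges x) := by
  classical
  have := measurableSingletonClass (V := V)
  rw [integral_fintype .of_finite, BernoulliCube.expect]
  refine (Fintype.sum_bijective _ bijective_ofPossibleEdges _ _ fun x => ?_).symm
  rw [smul_eq_mul]
  congr 1
  rw [measureReal_def, binomialRandom_singleton, ncard_edgeSet_ofPossibleEdges,
    BernoulliCube.weight, Sym2.card_subtype_not_diag, Nat.card_eq_fintype_card]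
  simp

end SimpleGraph

/-! ### The explicit bound and the rate. -/

open BernoulliCube SimpleGraph in
/-- A quantitative version of the central limit theorem for subgraph counts. -/
lemma kolmogorovDist_normalizedSubgraphCount_le {W : Type*} [Finite W] {Γ : SimpleGraph W}
    (hΓ : Γ.edgeSet.Nonempty) {p : unitInterval} (hp0 : 0 < p) (hp1 : p < 1)
    {Ω : Type*} [MeasurableSpace Ω] {P : Measure Ω} {N : Ω → ℝ}
    (hN : HasLaw N (gaussianReal 0 1) P) {n : ℕ} (hn : 2 ≤ n) (hW : Nat.card W ≤ n) :
    kolmogorovDist (normalizedSubgraphCount Γ p n) (binomialRandom (Fin n) p) N P ≤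
      3 * (1 + 4 * Γ.edgeSet.ncard) /
        (((1 - p) * p ^ Γ.edgeSet.ncard) ^ 2 * √(n.choose 2)) := by
  have := Fintype.ofFinite W
  have := measurableSingletonClass (V := Fin n)
  have hp0' : (0 : ℝ) < p := hp0
  have hp1' : (p : ℝ) < 1 := hp1
  set k := Γ.edgeSet.ncard with hk
  have hk0 : 0 < k := (Set.ncard_pos (Set.toFinite _)).2 hΓ
  have hcard : Fintype.card (PossibleEdge (Fin n)) = n.choose 2 := by
    rw [Sym2.card_subtype_not_diag, Fintype.card_fin]
  have hcard0 : 0 < Fintype.card (PossibleEdge (Fin n)) := by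
    rw [hcard]; exact Nat.choose_pos hn
  obtain ⟨e₀⟩ : Nonempty (PossibleEdge (Fin n)) := Fintype.card_pos_iff.1 hcard0
  set 𝓗 := completeCopies (Fin n) Γ with h𝓗
  have hunif : ∀ H ∈ 𝓗, (possibleEdges H).card = k := fun H hH => card_possibleEdges hH
  have hreg : ∀ e, (𝓗.filter fun H => e ∈ possibleEdges H).card =
      (𝓗.filter fun H => e₀ ∈ possibleEdges H).card := fun e =>
    le_antisymm (card_filter_mem_possibleEdges_le Γ e e₀)
      (card_filter_mem_possibleEdges_le Γ e₀ e)
  set d := (𝓗.filter fun H => e₀ ∈ possibleEdges H).card with hd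
  have h𝓗0 : 0 < 𝓗.card := by
    rw [Nat.card_eq_fintype_card] at hW
    obtain ⟨φ⟩ : Nonempty (W ↪ Fin n) :=
      Function.Embedding.nonempty_of_card_le (by rwa [Fintype.card_fin])
    exact Finset.card_pos.2
      ⟨_, mem_completeCopies.2 ⟨⟨⟨φ, fun h => φ.injective.ne h.ne⟩, φ.injective⟩, rfl⟩⟩
  -- A copy exists because `W` embeds into `Fin n`, and it has an edge, so double counting forces a
  -- positive degree.
  have hd0 : 0 < d := by
    have h := card_mul_eq_of_regular hunif hreg
    exact Nat.pos_of_mul_pos_left (h ▸ Nat.mul_pos h𝓗0 hk0)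
  have hcount : ∀ x : Finset (PossibleEdge (Fin n)),
      subgraphCount Γ n (ofPossibleEdges x) = containedCount 𝓗 possibleEdges x := fun x =>
    copyCount_ofPossibleEdges Γ x
  have hmean : ∫ H, subgraphCount Γ n H ∂(binomialRandom (Fin n) p) =
      expect (p : ℝ) (containedCount 𝓗 possibleEdges) := by
    rw [integral_binomialRandom]
    simp only [hcount]
  have hvar : variance (subgraphCount Γ n) (binomialRandom (Fin n) p) =
      expect (p : ℝ) fun x => (containedCount 𝓗 possibleEdges x -
        expect (p : ℝ) (containedCount 𝓗 possibleEdges)) ^ 2 := by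
    rw [variance_eq_integral (measurable_of_finite _).aemeasurable, integral_binomialRandom, hmean]
    simp only [hcount]
  -- The real supremum has default value 0, so the bound must also be shown nonnegative.
  refine Real.iSup_le (fun z => ?_) ?_
  · have hNz : P.real {ω | N ω ≤ z} = normalCDF z := by
      rw [normalCDF, ← hN.map_eq, map_measureReal_apply_of_aemeasurable hN.aemeasurable
        measurableSet_Iic]
      rfl
    have hFz : (binomialRandom (Fin n) p).real {G | normalizedSubgraphCount Γ p n G ≤ z} =
        expect (p : ℝ) fun x => if (containedCount 𝓗 possibleEdges x -
          expect (p : ℝ) (containedCount 𝓗 possibleEdges)) /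
          √(expect (p : ℝ) fun x => (containedCount 𝓗 possibleEdges x -
            expect (p : ℝ) (containedCount 𝓗 possibleEdges)) ^ 2) ≤ z then 1 else 0 := by
      rw [← integral_indicator_one (Set.toFinite _).measurableSet, integral_binomialRandom]
      simp only [Set.indicator_apply, Set.mem_ofPred_eq, normalizedSubgraphCount, hmean, hvar,
        hcount, Pi.one_apply]
    rw [hNz, hFz, ← hcard]
    exact abs_expect_containedCount_sub_normalCDF_le hp0' hp1' hunif hreg hd0 hcard0 z
  · have : (0 : ℝ) < 1 - p := sub_pos.2 hp1'
    positivity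

theorem theorem1p2 {W : Type*} [Finite W] (Γ : SimpleGraph W) (hΓ : Γ.edgeSet.Nonempty)
    (p : unitInterval) (hp0 : 0 < p) (hp1 : p < 1)
    {Ω : Type*} [MeasurableSpace Ω] (P : Measure Ω) (N : Ω → ℝ)
    (hN : HasLaw N (gaussianReal 0 1) P) :
    (fun n : ℕ => kolmogorovDist (normalizedSubgraphCount Γ p n)
        (SimpleGraph.binomialRandom (Fin n) p) N P)
      =O[atTop] (fun n : ℕ => (n : ℝ)⁻¹) := by
  have hp0' : (0 : ℝ) < p := hp0
  have hp1' : (0 : ℝ) < 1 - p := sub_pos.2 hp1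
  set k := Γ.edgeSet.ncard
  set c : ℝ := (1 - p) * p ^ k
  have hc : 0 < c := mul_pos hp1' (pow_pos hp0' _)
  refine IsBigO.of_bound (3 * (1 + 4 * k) / c ^ 2 * 2) ?_
  filter_upwards [eventually_ge_atTop 2, eventually_ge_atTop (Nat.card W)] with n hn hW
  have hn' : (2 : ℝ) ≤ n := by exact_mod_cast hn
  -- For `n ≥ 2`, `n (n - 1) / 2 ≥ n² / 4`; this is the source of the factor 2 in the constant.
  have hsqrt : (n : ℝ) / 2 ≤ √(n.choose 2) := by
    refine Real.le_sqrt_of_sq_le ?_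
    rw [Nat.cast_choose_two]
    nlinarith
  have hnonneg : 0 ≤ kolmogorovDist (normalizedSubgraphCount Γ p n)
      (SimpleGraph.binomialRandom (Fin n) p) N P := Real.iSup_nonneg fun _ => abs_nonneg _
  rw [Real.norm_of_nonneg hnonneg, Real.norm_of_nonneg (by positivity)]
  calc _ ≤ 3 * (1 + 4 * k) / (c ^ 2 * √(n.choose 2)) :=
        kolmogorovDist_normalizedSubgraphCount_le hΓ hp0 hp1 hN hn hW
    _ ≤ 3 * (1 + 4 * k) / (c ^ 2 * (n / 2)) := by gcongr
    _ = _ := by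
        have : (n : ℝ) ≠ 0 := by positivity
        field_simp
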